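/- For $r\in[0,1)$ let $T_r\colon[0,1]\to[0,1]$ be given by $T_r(x)=\frac{(2-r)x}{1-rx}$ for $0\le x\le\frac12$ and $T_r(x)=\frac{(2-r)(1-x)}{1-r+rx}$ for $\frac12<x\le1$. Its inverse branches are $f_{r,0}(x)=\frac{x}{2-r+rx}$ and $f_{r,1}(x)=\frac{1+(1-r)(1-x)}{2-r+rx}$. The Perron–Frobenius operator of $T_r$ is taken pointwise, $$\mathcal P_r(v)=|f_{r,0}'|\cdot v\circ f_{r,0}+|f_{r,1}'|\cdot v\circ f_{r,1}.$$ Let $\lambda$ be Lebesgue measure, $h_0=1$, and $h_r(x)=\frac{-r}{\ln(1-r)}\cdot\frac{1}{1-r+rx}$ for $r\in(0,1)$. For $\alpha\in(0,1)$ and $\beta\in[0,1]$ let $\mathfrak U_{\beta,\alpha}$ be the set of functions $v\colon[0,1]\to\overline{\mathbb R}$ such that (a) $v(x)\to+\infty$ as $x\uparrow\beta$ and as $x\downarrow\beta$ (only the side inside $[0,1]$ if $\beta\in\{0,1\}$); (b) on $[0,1]\setminus\{\beta\}$ the function $v$ is real-valued and right-continuous, and it is of bounded variation on every compact interval contained in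 $[0,1]\setminus\{\beta\}$; (c) there are a connected, relatively open neighbourhood $U\subseteq[0,1]$ of $\beta$ and constants $C_1,C_2>0$ with $C_1|\beta-x|^{-\alpha}\le v(x)\le C_2|\beta-x|^{-\alpha}$ for all $x\in U$, where $|\beta-x|^{-\alpha}=+\infty$ at $x=\beta$ (so $v(\beta)=+\infty$). Let $\Omega_r(\beta)=\bigcap_{k\ge0}\overline{\{T_r^\ell(\beta):\ell\ge k\}}$. The point $\beta$ is pre-periodic for $T_r$ if there are $m\ge1$ and $n\ge0$ with $T_r^{n+k}(\beta)=T_r^{n+m+k}(\beta)$ for all $k\ge0$; the least such $m$ is its period length. **Theorem.** Let $r\in[0,1)$, $\alpha\in(0,1)$, $\beta\in[0,1]$ and $v\in\mathfrak U_{\beta,\alpha}$. Then $v$ is Lebesgue integrable on $[0,1]$ and the following hold. 1. On every compact subset of $[0,1]\setminus\Omega_r(\beta)$, $$\lim_{n\to\infty}\mathcal P_r^n(v)=\int v\,\mathrm d\lambda\cdot h_r$$ uniformly (for every $\varepsilon>0$ and all large $n$ the values $\mathcal P_r^n(v)(x)$ are finite and within $\varepsilon$ of the limit for all $x$ in the compact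 set). 2. There is a set $E\subseteq[0,1]$ of Hausdorff dimension zero such that this convergence holds pointwise on $[0,1]\setminus E$. 3. If $\beta$ is pre-periodic for $T_r$ with period length greater than one, then $\Omega_r(\beta)$ is finite and, at every point of $\Omega_r(\beta)$, $$\liminf_{n\to\infty}\mathcal P_r^n(v)=\int v\,\mathrm d\lambda\cdot h_r\quad\text{and}\quad\limsup_{n\to\infty}\mathcal P_r^n(v)=+\infty.$$ 4. If $\beta$ is pre-periodic for $T_r$ with period length one, then $\Omega_r(\beta)$ is a singleton, and at its point $\lim_{n\to\infty}\mathcal P_r^n(v)=+\infty$. -/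

import Mathlib

open Set Filter Topology MeasureTheory

noncomputable section

/-- The interval map `T_r`, given by its formula; it maps `[0,1]` to itself. -/
def markovMap (r x : ℝ) : ℝ :=
  if x ≤ 1 / 2 then (2 - r) * x / (1 - r * x)
  else (2 - r) * (1 - x) / (1 - r + r * x)

/-- The increasing inverse branch `f_{r,0}` of `T_r`; it maps `[0,1]` onto `[0,1/2]`. -/
def branchZero (r x : ℝ) : ℝ := x / (2 - r + r * x)

/-- The decreasing inverse branch `f_{r,1}` of `T_r`; it maps `[0,1]` onto `[1/2,1]`. -/
def branchOne (r x : ℝ) : ℝ := (1 + (1 - r) * (1 - x)) / (2 - r + r * x)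

/-- The invariant density `h_r` on `[0,1]`. -/
def invDensity (r x : ℝ) : ℝ :=
  if r = 0 then 1
  else if r = 1 then 1 / x
  else -r / Real.log (1 - r) * (1 / (1 - r + r * x))

/-- The Perron-Frobenius operator `P_r` of `T_r`, acting pointwise on extended-real-valued
functions. On `[0,1]` the value of `P_r v` depends only on the values of `v` on `[0,1]`. -/
def perronFrobenius (r : ℝ) (v : ℝ → EReal) : ℝ → EReal := fun x =>
  ((|deriv (branchZero r) x| : ℝ) : EReal) * v (branchZero r x)
    + ((|deriv (branchOne r) x| : ℝ) : EReal) * v (branchOne r x)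

/-- `|β - x| ^ (-α)` as an extended real number; for `α > 0` it is `+∞` at `x = β`. -/
def singularity (β α x : ℝ) : EReal :=
  ((ENNReal.ofReal |β - x| ^ (-α) : ENNReal) : EReal)

/-- The class of observables on `[0,1]` with a singularity of order `α` at `β`. Only the values
of `v` on `[0,1]` matter; all limits and neighbourhoods are relative to `[0,1]`. -/
structure SingularObservable (β α : ℝ) (v : ℝ → EReal) : Prop where
  /-- `v` tends to `+∞` at `β` from the left (no condition if `β = 0`). -/
  tendsto_left : Tendsto v (𝓝[Ico 0 β] β) (𝓝 ⊤)
  /-- `v` tends to `+∞` at `β` from the right (no condition if `β = 1`). -/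
  tendsto_right : Tendsto v (𝓝[Ioc β 1] β) (𝓝 ⊤)
  /-- `v` is real-valued off `β`. -/
  finite : ∀ x ∈ Icc (0 : ℝ) 1, x ≠ β → v x ≠ ⊥ ∧ v x ≠ ⊤
  /-- `v` is right-continuous off `β`. -/
  rightCont : ∀ x ∈ Icc (0 : ℝ) 1, x ≠ β → ContinuousWithinAt v (Icc x 1) x
  /-- `v` is of bounded variation on each compact interval that does not contain `β`. -/
  boundedVariation : ∀ a b : ℝ, Icc a b ⊆ Icc 0 1 \ {β} →
    BoundedVariationOn (fun x => (v x).toReal) (Icc a b)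
  /-- `v` is of exact order `|β - x| ^ (-α)` on a connected relatively open neighbourhood
  `U` of `β` in `[0,1]`, `β` included. -/
  order : ∃ U : Set ℝ, (∃ O : Set ℝ, IsOpen O ∧ U = O ∩ Icc 0 1) ∧ IsConnected U ∧ β ∈ U ∧
    ∃ C₁ C₂ : ℝ, 0 < C₁ ∧ 0 < C₂ ∧ ∀ x ∈ U,
      (C₁ : EReal) * singularity β α x ≤ v x ∧ v x ≤ (C₂ : EReal) * singularity β α x

/-- The `ω`-limit set of `β` with respect to `T_r`. -/
def omegaLimitSet (r β : ℝ) : Set ℝ :=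
  ⋂ k : ℕ, closure {y | ∃ l : ℕ, k ≤ l ∧ y = (markovMap r)^[l] β}

/-- The positive integers `m` for which there is `n` with
`T_r^{n+k}(x) = T_r^{n+m+k}(x)` for all `k`. -/
def eventualPeriods (r x : ℝ) : Set ℕ :=
  {m | 1 ≤ m ∧ ∃ n : ℕ, ∀ k : ℕ, (markovMap r)^[n + k] x = (markovMap r)^[n + m + k] x}

/-- `x` is pre-periodic with respect to `T_r`. -/
def IsPreperiodic (r x : ℝ) : Prop := (eventualPeriods r x).Nonempty

/-- The period length of a pre-periodic point. -/
def periodLength (r x : ℝ) : ℕ := sInf (eventualPeriods r x)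

/-- The equilibrium value `∫ v dλ · h_r(x)`. -/
def equilibrium (r : ℝ) (v : ℝ → EReal) (x : ℝ) : ℝ :=
  (∫ t in Icc (0 : ℝ) 1, (v t).toReal) * invDensity r x

end

/-! Multiplication by `1 - r + r * x`, the reciprocal of the invariant density up to a constant,
conjugates the Perron–Frobenius operator to an averaging operator `normalizedTransfer` whose two
weights sum to one. Two points that follow the same inverse branches approach each other at rate `1
/ (2 - r) < 1`. This gives bounded distortion, hence a Harnack inequality
(`normalizedTransfer_harnack`). For an observable of bounded variation the oscillation along
branches, averaged with the weights, decays geometrically. Harnack then forces uniform convergence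
to a constant (`HasVanishingOscillation.exists_limit`), and conservation of the integral identifies
that constant (`realTransfer_tendsto`).

The pole is controlled by comparison with the kernel `|b - x| ^ (-a)`. One application of the
operator moves the pole from `b` to `T_r b` and multiplies the kernel by at most `κ = (1 / (2 - r))
^ (1 - a) < 1`, up to a bounded error. Near the folding point `1/2` both preimages of `x` can be
close to `b`, which costs a further factor `2`; a weight `ψ` of the position of the pole absorbs it
(`exists_folding_weight`). Thus the `n`-th iterate is at most `C * (ρ ^ n * |T_r^n b - x| ^ (-a) +
1)` with `ρ < 1`.

Truncating `v` at a large height gives a function of bounded variation below `v`, which yields the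
lower bound everywhere. For any `α'` in `(α, 1)`, the excess of `v` over a high truncation is at
most `ε * |β - x| ^ (-α')`, so the kernel estimate yields the upper bound at every `x` with `|T_r^n
β - x| ≥ σ ^ n`, for some `σ < 1`. At `T_r^n β` itself the iterate is `+∞`. It remains to see which
points stay outside these shrinking balls: uniformly so a compact set off the limit set, eventually
so all points outside a set of dimension zero, and, when `β` is pre-periodic, each point at the
large times when the finite orbit of `β` is not exactly there. -/

noncomputable section

/-! ### Inverse branches and the interval map -/

/-- The common modulus of the derivatives of both inverse branches. -/
def branchWeight (r x : ℝ) : ℝ := (2 - r) / (2 - r + r * x) ^ 2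

lemma branch_denom_ge {r x : ℝ} (hr : r ∈ Ico (0 : ℝ) 1) (hx : x ∈ Icc (0 : ℝ) 1) :
    2 - r ≤ 2 - r + r * x := by nlinarith [mul_nonneg hr.1 hx.1]

lemma branch_denom_gt_one {r x : ℝ} (hr : r ∈ Ico (0 : ℝ) 1) (hx : x ∈ Icc (0 : ℝ) 1) :
    1 < 2 - r + r * x := by linarith [branch_denom_ge hr hx, hr.2]

lemma branch_denom_pos {r x : ℝ} (hr : r ∈ Ico (0 : ℝ) 1) (hx : x ∈ Icc (0 : ℝ) 1) :
    0 < 2 - r + r * x := by linarith [branch_denom_gt_one hr hx]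

/-- This reflection symmetry reduces every estimate for the decreasing branch to one for the
increasing branch. -/
lemma branchOne_eq {r x : ℝ} (hr : r ∈ Ico (0 : ℝ) 1) (hx : x ∈ Icc (0 : ℝ) 1) :
    branchOne r x = 1 - branchZero r x := by
  have := branch_denom_pos hr hx
  unfold branchOne branchZero
  field_simp
  ring

lemma branchZero_mem_half {r x : ℝ} (hr : r ∈ Ico (0 : ℝ) 1) (hx : x ∈ Icc (0 : ℝ) 1) :
    branchZero r x ∈ Icc (0 : ℝ) (1 / 2) := by
  have := branch_denom_pos hr hx
  refine ⟨div_nonneg hx.1 this.le, ?_⟩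
  unfold branchZero
  rw [div_le_iff₀ this]
  nlinarith [mul_nonneg (sub_nonneg.2 hx.2) (by linarith [hr.2] : (0:ℝ) ≤ 2 - r)]

lemma branchZero_mem {r x : ℝ} (hr : r ∈ Ico (0 : ℝ) 1) (hx : x ∈ Icc (0 : ℝ) 1) :
    branchZero r x ∈ Icc (0 : ℝ) 1 :=
  Icc_subset_Icc_right (by norm_num) (branchZero_mem_half hr hx)

lemma branchOne_mem {r x : ℝ} (hr : r ∈ Ico (0 : ℝ) 1) (hx : x ∈ Icc (0 : ℝ) 1) :
    branchOne r x ∈ Icc (0 : ℝ) 1 := by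
  rw [branchOne_eq hr hx]
  have := branchZero_mem hr hx
  exact ⟨by linarith [this.2], by linarith [this.1]⟩

lemma branchZero_sub {r x y : ℝ} (hr : r ∈ Ico (0 : ℝ) 1) (hx : x ∈ Icc (0 : ℝ) 1)
    (hy : y ∈ Icc (0 : ℝ) 1) : branchZero r x - branchZero r y =
      (2 - r) / ((2 - r + r * x) * (2 - r + r * y)) * (x - y) := by
  have h1 := branch_denom_pos hr hx
  have h2 := branch_denom_pos hr hy
  unfold branchZero
  rw [div_sub_div _ _ h1.ne' h2.ne', div_mul_eq_mul_div]
  congr 1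
  ring

lemma abs_branchZero_sub {r x y : ℝ} (hr : r ∈ Ico (0 : ℝ) 1) (hx : x ∈ Icc (0 : ℝ) 1)
    (hy : y ∈ Icc (0 : ℝ) 1) : |branchZero r x - branchZero r y| =
      (2 - r) / ((2 - r + r * x) * (2 - r + r * y)) * |x - y| := by
  have h1 := branch_denom_pos hr hx
  have h2 := branch_denom_pos hr hy
  rw [branchZero_sub hr hx hy, abs_mul, abs_of_pos]
  have : 0 < 2 - r := by linarith [hr.2]
  positivity

lemma abs_branchOne_sub {r x y : ℝ} (hr : r ∈ Ico (0 : ℝ) 1) (hx : x ∈ Icc (0 : ℝ) 1)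
    (hy : y ∈ Icc (0 : ℝ) 1) :
    |branchOne r x - branchOne r y| = |branchZero r x - branchZero r y| := by
  rw [branchOne_eq hr hx, branchOne_eq hr hy, ← abs_neg]
  congr 1
  ring

/-- The contraction ratio of the inverse branches. -/
lemma contraction_lt_one {r : ℝ} (hr : r ∈ Ico (0 : ℝ) 1) : 1 / (2 - r) < 1 := by
  rw [div_lt_one (by linarith [hr.2])]
  linarith [hr.2]

lemma contraction_pos {r : ℝ} (hr : r ∈ Ico (0 : ℝ) 1) : 0 < 1 / (2 - r) :=
  div_pos one_pos (by linarith [hr.2])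

lemma branchWeight_pos {r x : ℝ} (hr : r ∈ Ico (0 : ℝ) 1) (hx : x ∈ Icc (0 : ℝ) 1) :
    0 < branchWeight r x :=
  div_pos (by linarith [hr.2]) (pow_pos (branch_denom_pos hr hx) 2)

lemma abs_branchZero_sub_le {r x y : ℝ} (hr : r ∈ Ico (0 : ℝ) 1) (hx : x ∈ Icc (0 : ℝ) 1)
    (hy : y ∈ Icc (0 : ℝ) 1) :
    |branchZero r x - branchZero r y| ≤ 1 / (2 - r) * |x - y| := by
  rw [abs_branchZero_sub hr hx hy]
  refine mul_le_mul_of_nonneg_right ?_ (abs_nonneg _)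
  have h0 : 0 < 2 - r := by linarith [hr.2]
  have h1 := branch_denom_ge hr hx
  have h2 := branch_denom_ge hr hy
  rw [div_le_div_iff₀ (by nlinarith) h0, one_mul]
  nlinarith

lemma branchWeight_le {r x : ℝ} (hr : r ∈ Ico (0 : ℝ) 1) (hx : x ∈ Icc (0 : ℝ) 1) :
    branchWeight r x ≤ 1 / (2 - r) := by
  have h0 : 0 < 2 - r := by linarith [hr.2]
  have h1 := branch_denom_ge hr hx
  unfold branchWeight
  rw [div_le_div_iff₀ (by nlinarith) h0, one_mul]
  nlinarith

lemma hasDerivAt_branchZero {r x : ℝ} (hr : r ∈ Ico (0 : ℝ) 1) (hx : x ∈ Icc (0 : ℝ) 1) :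
    HasDerivAt (branchZero r) (branchWeight r x) x := by
  have h := branch_denom_pos hr hx
  have h1 : HasDerivAt (fun y => 2 - r + r * y) r x := by
    simpa using ((hasDerivAt_id x).const_mul r).const_add (2 - r)
  convert! (hasDerivAt_id x).div h1 h.ne' using 1
  unfold branchWeight
  congr 1
  simp only [id]
  ring

lemma hasDerivAt_branchOne {r x : ℝ} (hr : r ∈ Ico (0 : ℝ) 1) (hx : x ∈ Icc (0 : ℝ) 1) :
    HasDerivAt (branchOne r) (-branchWeight r x) x := by
  have h := branch_denom_pos hr hx
  have h1 : HasDerivAt (fun y => 2 - r + r * y) r x := by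
    simpa using ((hasDerivAt_id x).const_mul r).const_add (2 - r)
  have h2 : HasDerivAt (fun y => 1 + (1 - r) * (1 - y)) (-(1 - r)) x := by
    simpa using! (((hasDerivAt_id x).const_sub 1).const_mul (1 - r)).const_add 1
  convert! h2.div h1 h.ne' using 1
  unfold branchWeight
  rw [← neg_div]
  congr 1
  ring

lemma markovMap_one_sub {r x : ℝ} (hr : r ∈ Ico (0 : ℝ) 1) (hx : x ∈ Icc (0 : ℝ) 1) :
    markovMap r (1 - x) = markovMap r x := by
  have h2 : 0 < 2 - r := by linarith [hr.2]
  unfold markovMap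
  rcases lt_trichotomy x (1 / 2) with h | h | h
  · rw [if_neg (by linarith), if_pos h.le]
    congr 1 <;> ring
  · subst h
    norm_num
  · rw [if_pos (by linarith), if_neg (by linarith)]
    congr 1
    ring

lemma markovMap_mem_of_le {r x : ℝ} (hr : r ∈ Ico (0 : ℝ) 1) (hx : x ∈ Icc (0 : ℝ) (1 / 2)) :
    markovMap r x ∈ Icc (0 : ℝ) 1 := by
  obtain ⟨h0, h1⟩ := hr
  obtain ⟨hx0, hx1⟩ := hx
  have h2 : 0 < 1 - r * x := by nlinarith
  rw [markovMap, if_pos hx1]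
  refine ⟨div_nonneg (by nlinarith) h2.le, ?_⟩
  rw [div_le_one h2]
  nlinarith

lemma markovMap_mem {r x : ℝ} (hr : r ∈ Ico (0 : ℝ) 1) (hx : x ∈ Icc (0 : ℝ) 1) :
    markovMap r x ∈ Icc (0 : ℝ) 1 := by
  rcases le_total x (1 / 2) with h | h
  · exact markovMap_mem_of_le hr ⟨hx.1, h⟩
  · rw [← markovMap_one_sub hr hx]
    exact markovMap_mem_of_le hr ⟨by linarith [hx.2], by linarith⟩

lemma markovMap_iterate_mem {r x : ℝ} (hr : r ∈ Ico (0 : ℝ) 1) (hx : x ∈ Icc (0 : ℝ) 1) (n : ℕ) :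
    (markovMap r)^[n] x ∈ Icc (0 : ℝ) 1 := by
  induction n generalizing x with
  | zero => exact hx
  | succ n ih => exact ih (markovMap_mem hr hx)

lemma branchZero_markovMap {r x : ℝ} (hr : r ∈ Ico (0 : ℝ) 1) (hx : x ∈ Icc (0 : ℝ) (1 / 2)) :
    branchZero r (markovMap r x) = x := by
  have hd := branch_denom_pos hr (markovMap_mem_of_le hr hx)
  obtain ⟨h0, h1⟩ := hr
  obtain ⟨hx0, hx1⟩ := hx
  have h2 : 0 < 1 - r * x := by nlinarith
  unfold branchZero
  rw [div_eq_iff hd.ne', markovMap, if_pos hx1]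
  field_simp
  ring

lemma branchOne_markovMap {r x : ℝ} (hr : r ∈ Ico (0 : ℝ) 1) (hx : x ∈ Icc (1 / 2 : ℝ) 1) :
    branchOne r (markovMap r x) = x := by
  have hx' : x ∈ Icc (0 : ℝ) 1 := ⟨by linarith [hx.1], hx.2⟩
  rw [branchOne_eq hr (markovMap_mem hr hx'), ← markovMap_one_sub hr hx',
    branchZero_markovMap hr ⟨by linarith [hx.2], by linarith [hx.1]⟩]
  ring

/-- On `[0, 1/2]` the map is convex with values `0` and `1` at the ends, so it lies below its chord.
-/
lemma markovMap_le_two_mul {r x : ℝ} (hr : r ∈ Ico (0 : ℝ) 1) (hx : x ∈ Icc (0 : ℝ) (1 / 2)) :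
    markovMap r x ≤ 2 * x := by
  obtain ⟨h0, h1⟩ := hr
  obtain ⟨hx0, hx1⟩ := hx
  have h2 : 0 < 1 - r * x := by nlinarith
  rw [markovMap, if_pos hx1, div_le_iff₀ h2]
  nlinarith [mul_nonneg (mul_nonneg h0 hx0) (by linarith : (0:ℝ) ≤ 1 - 2 * x)]

/-- By convexity the graph lies above its tangent at `1/2`, whose slope `4 / (2 - r)` is at most
`4`. -/
lemma one_sub_markovMap_le {r x : ℝ} (hr : r ∈ Ico (0 : ℝ) 1) (hx : x ∈ Icc (0 : ℝ) (1 / 2)) :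
    1 - markovMap r x ≤ 4 * (1 / 2 - x) := by
  obtain ⟨h0, h1⟩ := hr
  obtain ⟨hx0, hx1⟩ := hx
  have h2 : 0 < 1 - r * x := by nlinarith
  rw [markovMap, if_pos hx1, sub_le_comm, le_div_iff₀ h2]
  nlinarith [mul_nonneg (sub_nonneg.2 hx1) (by nlinarith : (0:ℝ) ≤ 1 - 2 * (r * x))]

/-! ### Normalized transfer operator and pairs of points following the same branches -/

/-- The weight of the increasing branch in the normalized transfer operator. -/
def probZero (r x : ℝ) : ℝ := 1 / (2 - r + r * x)

/-- The weight of the decreasing branch in the normalized transfer operator. -/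
def probOne (r x : ℝ) : ℝ := (1 - r + r * x) / (2 - r + r * x)

/-- The transfer operator normalized by the invariant density. -/
def normalizedTransfer (r : ℝ) (φ : ℝ → ℝ) : ℝ → ℝ := fun x =>
  probZero r x * φ (branchZero r x) + probOne r x * φ (branchOne r x)

/-- The normalized transfer operator on functions of two points that follow the same branches,
weighted by the first point. -/
def pairTransfer (r : ℝ) (Φ : ℝ → ℝ → ℝ) : ℝ → ℝ → ℝ := fun x y =>
  probZero r x * Φ (branchZero r x) (branchZero r y)
    + probOne r x * Φ (branchOne r x) (branchOne r y)

/-- The Perron-Frobenius operator on real-valued functions. -/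
def realTransfer (r : ℝ) (u : ℝ → ℝ) : ℝ → ℝ := fun x =>
  branchWeight r x * (u (branchZero r x) + u (branchOne r x))

lemma probZero_nonneg {r x : ℝ} (hr : r ∈ Ico (0 : ℝ) 1) (hx : x ∈ Icc (0 : ℝ) 1) :
    0 ≤ probZero r x := div_nonneg zero_le_one (branch_denom_pos hr hx).le

lemma probOne_nonneg {r x : ℝ} (hr : r ∈ Ico (0 : ℝ) 1) (hx : x ∈ Icc (0 : ℝ) 1) :
    0 ≤ probOne r x :=
  div_nonneg (by linarith [branch_denom_gt_one hr hx]) (branch_denom_pos hr hx).le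

lemma probZero_add_probOne {r x : ℝ} (hr : r ∈ Ico (0 : ℝ) 1) (hx : x ∈ Icc (0 : ℝ) 1) :
    probZero r x + probOne r x = 1 := by
  have h := branch_denom_pos hr hx
  unfold probZero probOne
  rw [← add_div, div_eq_one_iff_eq h.ne']
  ring

lemma probZero_le {r x : ℝ} (hr : r ∈ Ico (0 : ℝ) 1) (hx : x ∈ Icc (0 : ℝ) 1) :
    probZero r x ≤ 1 / (2 - r) :=
  one_div_le_one_div_of_le (by linarith [hr.2]) (branch_denom_ge hr hx)

lemma probOne_le {r x : ℝ} (hr : r ∈ Ico (0 : ℝ) 1) (hx : x ∈ Icc (0 : ℝ) 1) :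
    probOne r x ≤ 1 / (2 - r) := by
  have h := branch_denom_pos hr hx
  have h0 : 0 < 2 - r := by linarith [hr.2]
  unfold probOne
  rw [div_le_div_iff₀ h h0]
  nlinarith [mul_nonneg hr.1 (sub_nonneg.2 hx.2), mul_nonneg (mul_nonneg hr.1 hr.1)
    (sub_nonneg.2 hx.2), mul_nonneg hr.1 (sub_nonneg.2 hr.2.le), hr.1, hx.1, hr.2]

lemma probZero_le_mul {r x y : ℝ} (hr : r ∈ Ico (0 : ℝ) 1) (hx : x ∈ Icc (0 : ℝ) 1)
    (hy : y ∈ Icc (0 : ℝ) 1) :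
    probZero r x ≤ (1 + 2 / (1 - r) * |x - y|) * probZero r y := by
  have h1 := branch_denom_gt_one hr hx
  have h2 := branch_denom_gt_one hr hy
  have h3 : 0 < 1 - r := by linarith [hr.2]
  have h4 : 2 ≤ 2 / (1 - r) := by
    rw [le_div_iff₀ h3]; linarith [hr.1]
  have h5 : r * (y - x) ≤ |x - y| := by
    rw [abs_sub_comm]
    nlinarith [le_abs_self (y - x), abs_nonneg (y - x), hr.1, hr.2]
  unfold probZero
  rw [mul_one_div, div_le_div_iff₀ (by linarith) (by linarith)]
  have h6 : |x - y| ≤ 2 / (1 - r) * |x - y| := by nlinarith [abs_nonneg (x - y)]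
  nlinarith [mul_nonneg ((abs_nonneg (x - y)).trans h6) (by linarith : 0 ≤ 2 - r + r * x - 1)]

/-- Unlike the increasing branch, this weight can be small, but its numerator is at least `1 - r`;
this is the source of the denominator in the distortion constant. -/
lemma probOne_le_mul {r x y : ℝ} (hr : r ∈ Ico (0 : ℝ) 1) (hx : x ∈ Icc (0 : ℝ) 1)
    (hy : y ∈ Icc (0 : ℝ) 1) :
    probOne r x ≤ (1 + 2 / (1 - r) * |x - y|) * probOne r y := by
  have h1 := branch_denom_gt_one hr hx
  have h2 := branch_denom_gt_one hr hy
  have h3 : 0 < 1 - r := by linarith [hr.2]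
  have h5 : r * (x - y) ≤ |x - y| := by
    nlinarith [le_abs_self (x - y), abs_nonneg (x - y), hr.1, hr.2]
  have h8 : 1 - r ≤ 1 - r + r * y := by nlinarith [hr.1, hy.1]
  have h7 : |x - y| ≤ 1 / (1 - r) * |x - y| * (1 - r + r * y) := by
    rw [div_mul_eq_mul_div, div_mul_eq_mul_div, le_div_iff₀ h3, one_mul]
    exact mul_le_mul_of_nonneg_left h8 (abs_nonneg _)
  have h9 : probOne r x - probOne r y ≤ |x - y| / (2 - r + r * y) := by
    unfold probOne
    rw [div_sub_div _ _ (by linarith) (by linarith), div_le_div_iff₀ (by positivity)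
      (by linarith)]
    have : (1 - r + r * x) * (2 - r + r * y) - (2 - r + r * x) * (1 - r + r * y)
      = r * (x - y) := by ring
    rw [this]
    nlinarith [mul_le_mul_of_nonneg_right h5 (by linarith : 0 ≤ 2 - r + r * y),
      mul_nonneg (abs_nonneg (x - y)) (mul_nonneg (by linarith : 0 ≤ 2 - r + r * x - 1)
        (by linarith : 0 ≤ 2 - r + r * y))]
  have h10 : |x - y| / (2 - r + r * y) ≤ 2 / (1 - r) * |x - y| * probOne r y := by
    unfold probOne
    rw [← mul_div_assoc]
    refine div_le_div_of_nonneg_right ?_ (by linarith)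
    have : 2 / (1 - r) = 1 / (1 - r) + 1 / (1 - r) := by ring
    rw [this]
    nlinarith [abs_nonneg (x - y)]
  linarith

lemma pairTransfer_mono {r : ℝ} (hr : r ∈ Ico (0 : ℝ) 1) {Φ Ψ : ℝ → ℝ → ℝ}
    (h : ∀ x ∈ Icc (0 : ℝ) 1, ∀ y ∈ Icc (0 : ℝ) 1, Φ x y ≤ Ψ x y) (n : ℕ) :
    ∀ x ∈ Icc (0 : ℝ) 1, ∀ y ∈ Icc (0 : ℝ) 1,
      (pairTransfer r)^[n] Φ x y ≤ (pairTransfer r)^[n] Ψ x y := by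
  induction n with
  | zero => exact h
  | succ n ih =>
    intro x hx y hy
    rw [Function.iterate_succ_apply', Function.iterate_succ_apply']
    exact add_le_add
      (mul_le_mul_of_nonneg_left (ih _ (branchZero_mem hr hx) _ (branchZero_mem hr hy))
        (probZero_nonneg hr hx))
      (mul_le_mul_of_nonneg_left (ih _ (branchOne_mem hr hx) _ (branchOne_mem hr hy))
        (probOne_nonneg hr hx))

lemma pairTransfer_add (r : ℝ) (Φ Ψ : ℝ → ℝ → ℝ) (n : ℕ) :
    ∀ x y, (pairTransfer r)^[n] (fun a b => Φ a b + Ψ a b) x y =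
      (pairTransfer r)^[n] Φ x y + (pairTransfer r)^[n] Ψ x y := by
  induction n with
  | zero => intro x y; rfl
  | succ n ih =>
    intro x y
    simp only [Function.iterate_succ_apply']
    simp only [pairTransfer, ih]
    ring

lemma pairTransfer_const_mul (r c : ℝ) (Φ : ℝ → ℝ → ℝ) (n : ℕ) :
    ∀ x y, (pairTransfer r)^[n] (fun a b => c * Φ a b) x y =
      c * (pairTransfer r)^[n] Φ x y := by
  induction n with
  | zero => intro x y; rfl
  | succ n ih =>
    intro x y
    simp only [Function.iterate_succ_apply']
    simp only [pairTransfer, ih]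
    ring

lemma pairTransfer_nonneg {r : ℝ} (hr : r ∈ Ico (0 : ℝ) 1) {Φ : ℝ → ℝ → ℝ}
    (h : ∀ x ∈ Icc (0 : ℝ) 1, ∀ y ∈ Icc (0 : ℝ) 1, 0 ≤ Φ x y) (n : ℕ) :
    ∀ x ∈ Icc (0 : ℝ) 1, ∀ y ∈ Icc (0 : ℝ) 1, 0 ≤ (pairTransfer r)^[n] Φ x y := by
  intro x hx y hy
  have h1 := pairTransfer_mono hr (Φ := fun a b => 0 * Φ a b) (Ψ := Φ)
    (fun a ha b hb => by simpa using h a ha b hb) n x hx y hy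
  rwa [pairTransfer_const_mul, zero_mul] at h1

lemma pairTransfer_fst (r : ℝ) (φ : ℝ → ℝ) (n : ℕ) :
    ∀ x y, (pairTransfer r)^[n] (fun a _ => φ a) x y = (normalizedTransfer r)^[n] φ x := by
  induction n with
  | zero => intro x y; rfl
  | succ n ih =>
    intro x y
    simp only [Function.iterate_succ_apply']
    simp only [pairTransfer, normalizedTransfer, ih]

/-! ### Bounded distortion and the Harnack inequality -/

/-- Bounded distortion: exchanging the weights at `x` for those at `y` costs a bounded factor. -/
lemma pairTransfer_le_swap {r : ℝ} (hr : r ∈ Ico (0 : ℝ) 1) {Φ : ℝ → ℝ → ℝ}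
    (h : ∀ x ∈ Icc (0 : ℝ) 1, ∀ y ∈ Icc (0 : ℝ) 1, 0 ≤ Φ x y) (n : ℕ) :
    ∀ x ∈ Icc (0 : ℝ) 1, ∀ y ∈ Icc (0 : ℝ) 1, (pairTransfer r)^[n] Φ x y ≤
      Real.exp (2 / (1 - r) / (1 - 1 / (2 - r)) * |x - y|) *
        (pairTransfer r)^[n] (fun a b => Φ b a) y x := by
  have hθ := contraction_lt_one hr
  have h3 : 0 < 1 - r := by linarith [hr.2]
  set C := 2 / (1 - r) / (1 - 1 / (2 - r)) with hC
  have hC0 : 0 ≤ C := div_nonneg (by positivity) (by linarith)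
  -- `C` sums the geometric series of one-step distortions: the first step costs `2 / (1 - r) * |x -
  -- y|`, and the remaining ones start at distance at most `|x - y| / (2 - r)`.
  have hCeq : 2 / (1 - r) + C * (1 / (2 - r)) = C := by
    have : C * (1 - 1 / (2 - r)) = 2 / (1 - r) := div_mul_cancel₀ _ (by linarith)
    linarith
  induction n with
  | zero =>
    intro x hx y hy
    exact le_mul_of_one_le_left (h x hx y hy) (Real.one_le_exp (by positivity))
  | succ n ih =>
    intro x hx y hy
    simp only [Function.iterate_succ_apply']
    have key : ∀ p q D A B : ℝ, 0 ≤ q → p ≤ (1 + 2 / (1 - r) * |x - y|) * q → 0 ≤ A → 0 ≤ B →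
        D ≤ 1 / (2 - r) * |x - y| → A ≤ Real.exp (C * D) * B →
        p * A ≤ Real.exp (C * |x - y|) * (q * B) := by
      intro p q D A B hq hp hA hB hD hAB
      have e1 : 1 + 2 / (1 - r) * |x - y| ≤ Real.exp (2 / (1 - r) * |x - y|) := by
        linarith [Real.add_one_le_exp (2 / (1 - r) * |x - y|)]
      have e2 : Real.exp (C * D) ≤ Real.exp (C * (1 / (2 - r)) * |x - y|) := by
        rw [mul_assoc]
        exact Real.exp_le_exp.2 (mul_le_mul_of_nonneg_left hD hC0)
      calc p * A ≤ (Real.exp (2 / (1 - r) * |x - y|) * q) *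
            (Real.exp (C * (1 / (2 - r)) * |x - y|) * B) :=
            mul_le_mul (hp.trans (mul_le_mul_of_nonneg_right e1 hq))
              (hAB.trans (mul_le_mul_of_nonneg_right e2 hB)) hA (by positivity)
        _ = Real.exp (C * |x - y|) * (q * B) := by
            conv_rhs => rw [← hCeq, add_mul, Real.exp_add]
            ring
    have hsw : ∀ x ∈ Icc (0 : ℝ) 1, ∀ y ∈ Icc (0 : ℝ) 1, 0 ≤ Φ y x := fun x hx y hy => h y hy x hx
    have hn := pairTransfer_nonneg hr h n
    have hn' := pairTransfer_nonneg hr (Φ := fun a b => Φ b a) hsw n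
    have hx0 := branchZero_mem hr hx
    have hy0 := branchZero_mem hr hy
    have hx1 := branchOne_mem hr hx
    have hy1 := branchOne_mem hr hy
    have a1 := key _ _ _ _ _ (probZero_nonneg hr hy) (probZero_le_mul hr hx hy)
      (hn _ hx0 _ hy0) (hn' _ hy0 _ hx0) (abs_branchZero_sub_le hr hx hy) (ih _ hx0 _ hy0)
    have a2 := key _ _ _ _ _ (probOne_nonneg hr hy) (probOne_le_mul hr hx hy)
      (hn _ hx1 _ hy1) (hn' _ hy1 _ hx1)
      ((abs_branchOne_sub hr hx hy).le.trans (abs_branchZero_sub_le hr hx hy)) (ih _ hx1 _ hy1)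
    calc _ ≤ _ := add_le_add a1 a2
      _ = _ := by rw [← mul_add]; rfl

/-- A Harnack inequality for the iterates of the normalized transfer operator. -/
lemma normalizedTransfer_harnack {r : ℝ} (hr : r ∈ Ico (0 : ℝ) 1) {φ : ℝ → ℝ}
    (h : ∀ x ∈ Icc (0 : ℝ) 1, 0 ≤ φ x) (n : ℕ) :
    ∀ x ∈ Icc (0 : ℝ) 1, ∀ y ∈ Icc (0 : ℝ) 1, (normalizedTransfer r)^[n] φ x ≤
      Real.exp (2 / (1 - r) / (1 - 1 / (2 - r))) * ((normalizedTransfer r)^[n] φ y +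
        (pairTransfer r)^[n] (fun a b => |φ a - φ b|) y x) := by
  intro x hx y hy
  have hθ := contraction_lt_one hr
  have h3 : 0 < 1 - r := by linarith [hr.2]
  have hC0 : 0 ≤ 2 / (1 - r) / (1 - 1 / (2 - r)) := div_nonneg (by positivity) (by linarith)
  have hxy : |x - y| ≤ 1 := abs_le.2 ⟨by linarith [hx.1, hy.2], by linarith [hx.2, hy.1]⟩
  have a1 := pairTransfer_le_swap hr (Φ := fun a _ => φ a) (fun x hx y hy => h x hx) n x hx y hy
  rw [pairTransfer_fst] at a1
  have a2 := pairTransfer_mono hr (Φ := fun _ b => φ b) (Ψ := fun a b => φ a + |φ a - φ b|)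
    (fun a _ b _ => by linarith [neg_abs_le (φ a - φ b)]) n y hy x hx
  rw [pairTransfer_add r (fun a _ => φ a) (fun a b => |φ a - φ b|), pairTransfer_fst] at a2
  have a3 := pairTransfer_nonneg hr (Φ := fun _ b => φ b) (fun a _ b hb => h b hb) n y hy x hx
  refine a1.trans (mul_le_mul ?_ a2 a3 (Real.exp_pos _).le)
  exact Real.exp_le_exp.2 (mul_le_of_le_one_right hC0 hxy)

lemma normalizedTransfer_sub_const {r : ℝ} (hr : r ∈ Ico (0 : ℝ) 1) (φ : ℝ → ℝ) (c : ℝ) (n : ℕ) :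
    ∀ x ∈ Icc (0 : ℝ) 1,
      (normalizedTransfer r)^[n] (fun a => φ a - c) x = (normalizedTransfer r)^[n] φ x - c := by
  induction n with
  | zero => intro x _; rfl
  | succ n ih =>
    intro x hx
    simp only [Function.iterate_succ_apply']
    simp only [normalizedTransfer]
    rw [ih _ (branchZero_mem hr hx), ih _ (branchOne_mem hr hx)]
    linear_combination -c * probZero_add_probOne hr hx

lemma normalizedTransfer_nonneg {r : ℝ} (hr : r ∈ Ico (0 : ℝ) 1) {φ : ℝ → ℝ}
    (h : ∀ x ∈ Icc (0 : ℝ) 1, 0 ≤ φ x) (n : ℕ) :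
    ∀ x ∈ Icc (0 : ℝ) 1, 0 ≤ (normalizedTransfer r)^[n] φ x := by
  intro x hx
  rw [← pairTransfer_fst r φ n x x]
  exact pairTransfer_nonneg hr (Φ := fun a _ => φ a) (fun a ha _ _ => h a ha) n x hx x hx

lemma le_normalizedTransfer {r : ℝ} (hr : r ∈ Ico (0 : ℝ) 1) {φ : ℝ → ℝ} {c : ℝ}
    (h : ∀ x ∈ Icc (0 : ℝ) 1, c ≤ φ x) (n : ℕ) :
    ∀ x ∈ Icc (0 : ℝ) 1, c ≤ (normalizedTransfer r)^[n] φ x := by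
  intro x hx
  have h1 := normalizedTransfer_nonneg hr (φ := fun a => φ a - c)
    (fun a ha => sub_nonneg.2 (h a ha)) n x hx
  rw [normalizedTransfer_sub_const hr φ c n x hx] at h1
  linarith

lemma normalizedTransfer_le {r : ℝ} (hr : r ∈ Ico (0 : ℝ) 1) {φ : ℝ → ℝ} {c : ℝ}
    (h : ∀ x ∈ Icc (0 : ℝ) 1, φ x ≤ c) :
    ∀ x ∈ Icc (0 : ℝ) 1, normalizedTransfer r φ x ≤ c := by
  intro x hx
  have h1 := mul_le_mul_of_nonneg_left (h _ (branchZero_mem hr hx)) (probZero_nonneg hr hx)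
  have h2 := mul_le_mul_of_nonneg_left (h _ (branchOne_mem hr hx)) (probOne_nonneg hr hx)
  have h3 := probZero_add_probOne hr hx
  unfold normalizedTransfer
  calc _ ≤ _ := add_le_add h1 h2
    _ = c := by rw [← add_mul, h3, one_mul]

/-! ### Vanishing oscillation and convergence to a constant -/

lemma abs_probZero_sub_le {r x y : ℝ} (hr : r ∈ Ico (0 : ℝ) 1) (hx : x ∈ Icc (0 : ℝ) 1)
    (hy : y ∈ Icc (0 : ℝ) 1) : |probZero r x - probZero r y| ≤ |x - y| := by
  have h1 := branch_denom_gt_one hr hx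
  have h2 := branch_denom_gt_one hr hy
  unfold probZero
  rw [div_sub_div _ _ (by linarith) (by linarith), abs_div,
    abs_of_pos (mul_pos (by linarith : 0 < 2 - r + r * x) (by linarith : 0 < 2 - r + r * y))]
  have : 1 * (2 - r + r * y) - (2 - r + r * x) * 1 = -(r * (x - y)) := by ring
  rw [this, abs_neg, abs_mul, abs_of_nonneg hr.1]
  refine div_le_of_le_mul₀ (by nlinarith) (abs_nonneg _) ?_
  nlinarith [abs_nonneg (x - y), mul_le_mul_of_nonneg_left
    (by nlinarith : 1 ≤ (2 - r + r * x) * (2 - r + r * y)) (abs_nonneg (x - y)),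
    mul_le_mul_of_nonneg_right hr.2.le (abs_nonneg (x - y))]

lemma abs_probOne_sub {r x y : ℝ} (hr : r ∈ Ico (0 : ℝ) 1) (hx : x ∈ Icc (0 : ℝ) 1)
    (hy : y ∈ Icc (0 : ℝ) 1) :
    |probOne r x - probOne r y| = |probZero r x - probZero r y| := by
  rw [eq_sub_of_add_eq' (probZero_add_probOne hr hx),
    eq_sub_of_add_eq' (probZero_add_probOne hr hy), ← abs_neg]
  congr 1
  ring

lemma pairTransfer_abs_sub_le {r : ℝ} (hr : r ∈ Ico (0 : ℝ) 1) (n : ℕ) :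
    ∀ x ∈ Icc (0 : ℝ) 1, ∀ y ∈ Icc (0 : ℝ) 1,
      (pairTransfer r)^[n] (fun a b => |a - b|) x y ≤ (1 / (2 - r)) ^ n := by
  have hθ := contraction_pos hr
  suffices H : ∀ x ∈ Icc (0 : ℝ) 1, ∀ y ∈ Icc (0 : ℝ) 1,
      (pairTransfer r)^[n] (fun a b => |a - b|) x y ≤ (1 / (2 - r)) ^ n * |x - y| by
    intro x hx y hy
    refine (H x hx y hy).trans (mul_le_of_le_one_right (by positivity) ?_)
    exact abs_le.2 ⟨by linarith [hx.1, hy.2], by linarith [hx.2, hy.1]⟩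
  induction n with
  | zero => intro x _ y _; simp
  | succ n ih =>
    intro x hx y hy
    rw [Function.iterate_succ_apply']
    have h0 := ih _ (branchZero_mem hr hx) _ (branchZero_mem hr hy)
    have h1 := ih _ (branchOne_mem hr hx) _ (branchOne_mem hr hy)
    rw [abs_branchOne_sub hr hx hy] at h1
    have hb := mul_le_mul_of_nonneg_left (abs_branchZero_sub_le hr hx hy)
      (by positivity : 0 ≤ (1 / (2 - r)) ^ n)
    rw [← mul_assoc, ← pow_succ] at hb
    have h2 := mul_le_mul_of_nonneg_left (h0.trans hb) (probZero_nonneg hr hx)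
    have h3 := mul_le_mul_of_nonneg_left (h1.trans hb) (probOne_nonneg hr hx)
    unfold pairTransfer
    calc _ ≤ _ := add_le_add h2 h3
      _ = _ := by rw [← add_mul, probZero_add_probOne hr hx, one_mul]

/-- Bounded functions whose oscillation along inverse branches, averaged with the weights of the
normalized transfer operator, tends to zero uniformly. -/
structure HasVanishingOscillation (r : ℝ) (φ : ℝ → ℝ) : Prop where
  bounded : ∃ B : ℝ, 0 ≤ B ∧ ∀ x ∈ Icc (0 : ℝ) 1, |φ x| ≤ B
  vanishing : ∀ ε : ℝ, 0 < ε → ∀ᶠ n : ℕ in atTop, ∀ x ∈ Icc (0 : ℝ) 1, ∀ y ∈ Icc (0 : ℝ) 1,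
    (pairTransfer r)^[n] (fun a b => |φ a - φ b|) x y ≤ ε

lemma pow_contraction_eventually_le {r : ℝ} (hr : r ∈ Ico (0 : ℝ) 1) (c : ℝ) {ε : ℝ}
    (hε : 0 < ε) : ∀ᶠ n : ℕ in atTop, c * (1 / (2 - r)) ^ n ≤ ε := by
  have := (tendsto_pow_atTop_nhds_zero_of_lt_one (contraction_pos hr).le
    (contraction_lt_one hr)).const_mul c
  rw [mul_zero] at this
  exact this.eventually_le_const hε

/-- The convergence argument applies the oscillation bound to iterates of `φ`, so the class has to
be stable. Following the same branches with the weights of two different points adds an error of at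
most `2 * B * |a - b|`, which the contraction makes negligible. -/
lemma HasVanishingOscillation.normalizedTransfer {r : ℝ} (hr : r ∈ Ico (0 : ℝ) 1) {φ : ℝ → ℝ}
    (h : HasVanishingOscillation r φ) : HasVanishingOscillation r (normalizedTransfer r φ) := by
  obtain ⟨B, hB0, hB⟩ := h.bounded
  refine ⟨⟨B, hB0, fun x hx => abs_le.2 ⟨?_, ?_⟩⟩, fun ε hε => ?_⟩
  · exact le_normalizedTransfer hr (fun a ha => (abs_le.1 (hB a ha)).1) 1 x hx
  · exact normalizedTransfer_le hr (fun a ha => (abs_le.1 (hB a ha)).2) x hx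
  · have h1 := (tendsto_add_atTop_nat 1).eventually (h.vanishing (ε / 2) (by linarith))
    filter_upwards [h1, pow_contraction_eventually_le hr (2 * B) (half_pos hε)]
      with n h1 h2 x hx y hy
    have h3 := pairTransfer_mono hr
      (Φ := fun a b => |_root_.normalizedTransfer r φ a - _root_.normalizedTransfer r φ b|)
      (Ψ := fun a b => pairTransfer r (fun a b => |φ a - φ b|) a b + 2 * B * |a - b|) ?_ n x hx y hy
    · rw [pairTransfer_add r (pairTransfer r (fun a b => |φ a - φ b|)) (fun a b => 2 * B * |a - b|),
        pairTransfer_const_mul r _ (fun a b => |a - b|), ← Function.iterate_succ_apply] at h3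
      have h4 := mul_le_mul_of_nonneg_left (pairTransfer_abs_sub_le hr n x hx y hy)
        (by linarith : 0 ≤ 2 * B)
      linarith [h1 x hx y hy]
    · intro a ha b hb
      have e : _root_.normalizedTransfer r φ a - _root_.normalizedTransfer r φ b =
          probZero r a * (φ (branchZero r a) - φ (branchZero r b))
          + probOne r a * (φ (branchOne r a) - φ (branchOne r b))
          + (probZero r a - probZero r b) * φ (branchZero r b)
          + (probOne r a - probOne r b) * φ (branchOne r b) := by
        unfold _root_.normalizedTransfer; ring
      have b0 : |(probZero r a - probZero r b) * φ (branchZero r b)| ≤ |a - b| * B := by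
        rw [abs_mul]
        exact mul_le_mul (abs_probZero_sub_le hr ha hb) (hB _ (branchZero_mem hr hb))
          (abs_nonneg _) (abs_nonneg _)
      have b1 : |(probOne r a - probOne r b) * φ (branchOne r b)| ≤ |a - b| * B := by
        rw [abs_mul, abs_probOne_sub hr ha hb]
        exact mul_le_mul (abs_probZero_sub_le hr ha hb) (hB _ (branchOne_mem hr hb))
          (abs_nonneg _) (abs_nonneg _)
      rw [e]
      refine (abs_add_le _ _).trans ?_
      refine (add_le_add (abs_add_le _ _) le_rfl).trans ?_
      refine (add_le_add (add_le_add (abs_add_le _ _) le_rfl) le_rfl).trans ?_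
      rw [abs_mul (probZero r a), abs_mul (probOne r a), abs_of_nonneg (probZero_nonneg hr ha),
        abs_of_nonneg (probOne_nonneg hr ha)]
      unfold pairTransfer
      linarith

lemma HasVanishingOscillation.iterate {r : ℝ} (hr : r ∈ Ico (0 : ℝ) 1) {φ : ℝ → ℝ}
    (h : HasVanishingOscillation r φ) (n : ℕ) :
    HasVanishingOscillation r ((_root_.normalizedTransfer r)^[n] φ) := by
  induction n with
  | zero => exact h
  | succ n ih =>
    rw [Function.iterate_succ_apply']
    exact ih.normalizedTransfer hr

/-- The iterates of the normalized transfer operator converge uniformly to a constant. -/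
lemma HasVanishingOscillation.exists_limit {r : ℝ} (hr : r ∈ Ico (0 : ℝ) 1) {φ : ℝ → ℝ}
    (h : HasVanishingOscillation r φ) : ∃ a : ℝ, ∀ ε : ℝ, 0 < ε → ∀ᶠ n : ℕ in atTop,
      ∀ x ∈ Icc (0 : ℝ) 1, |(_root_.normalizedTransfer r)^[n] φ x - a| ≤ ε := by
  set L := _root_.normalizedTransfer r with hL
  obtain ⟨B, hB0, hB⟩ := h.bounded
  -- The limit is the supremum of all uniform lower bounds attained at some time; such a bound
  -- persists at all later times.
  let A : Set ℝ := {c | ∃ k : ℕ, ∀ x ∈ Icc (0 : ℝ) 1, c ≤ L^[k] φ x}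
  have hupper : ∀ k : ℕ, ∀ x ∈ Icc (0 : ℝ) 1, L^[k] φ x ≤ B := by
    intro k
    induction k with
    | zero => exact fun x hx => (abs_le.1 (hB x hx)).2
    | succ k ih =>
      rw [Function.iterate_succ_apply']
      exact normalizedTransfer_le hr ih
  have hAb : BddAbove A := ⟨B, fun c ⟨k, hk⟩ =>
    (hk 0 (by simp)).trans (hupper k 0 (by simp))⟩
  have hAn : A.Nonempty := ⟨-B, 0, fun x hx => (abs_le.1 (hB x hx)).1⟩
  refine ⟨sSup A, fun ε hε => ?_⟩
  set D := Real.exp (2 / (1 - r) / (1 - 1 / (2 - r))) with hD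
  have hD0 : 0 < D := Real.exp_pos _
  -- Above the lower bound `c`, Harnack leaves `D * (2 * η + η)`: `2 * η` from the value at a good
  -- point `y`, `η` from the oscillation.
  set η := ε / (3 * D + 1) with hη
  have hη0 : 0 < η := by positivity
  have hηε : η * (3 * D + 1) = ε := div_mul_cancel₀ _ (by positivity)
  obtain ⟨c, ⟨k, hk⟩, hc⟩ := exists_lt_of_lt_csSup hAn (sub_lt_self (sSup A) hη0)
  have hcA : c ≤ sSup A := le_csSup hAb ⟨k, hk⟩
  obtain ⟨N, hN⟩ := eventually_atTop.1 ((h.iterate hr k).vanishing η hη0)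
  filter_upwards [eventually_ge_atTop (N + k)] with m hm x hx
  obtain ⟨n, rfl⟩ := Nat.exists_eq_add_of_le' (le_of_add_le_right hm)
  have hn : N ≤ n := by omega
  rw [Function.iterate_add_apply]
  have hlow := le_normalizedTransfer hr hk n x hx
  -- If the iterate were at least `sSup A + η` everywhere, that number would belong to `A`.
  obtain ⟨y, hy, hy2⟩ : ∃ y ∈ Icc (0 : ℝ) 1, L^[n + k] φ y < sSup A + η := by
    by_contra! hcon
    have := le_csSup hAb (show sSup A + η ∈ A from ⟨n + k, hcon⟩)
    linarith
  rw [Function.iterate_add_apply] at hy2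
  have hh := normalizedTransfer_harnack hr (φ := fun a => L^[k] φ a - c)
    (fun a ha => sub_nonneg.2 (hk a ha)) n x hx y hy
  rw [normalizedTransfer_sub_const hr _ _ _ x hx, normalizedTransfer_sub_const hr _ _ _ y hy] at hh
  simp only [sub_sub_sub_cancel_right] at hh
  have hv := hN n hn y hy x hx
  have h3 : L^[n] (L^[k] φ) x - c ≤ D * (3 * η) :=
    hh.trans (mul_le_mul_of_nonneg_left (by linarith) hD0.le)
  rw [abs_le]
  constructor <;> nlinarith

/-! ### Functions of bounded variation -/

lemma monotoneOn_branchZero {r : ℝ} (hr : r ∈ Ico (0 : ℝ) 1) :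
    MonotoneOn (branchZero r) (Icc 0 1) := by
  intro x hx y hy hxy
  rw [← sub_nonneg, branchZero_sub hr hy hx]
  have := branch_denom_pos hr hx
  have := branch_denom_pos hr hy
  have : 0 < 2 - r := by linarith [hr.2]
  exact mul_nonneg (by positivity) (sub_nonneg.2 hxy)

lemma antitoneOn_branchOne {r : ℝ} (hr : r ∈ Ico (0 : ℝ) 1) :
    AntitoneOn (branchOne r) (Icc 0 1) := by
  intro x hx y hy hxy
  rw [branchOne_eq hr hx, branchOne_eq hr hy]
  linarith [monotoneOn_branchZero hr hx hy hxy]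

/-- The branches are monotone with images in the two halves of `[0, 1]`, and variation is additive
over these halves. -/
lemma eVariationOn_comp_branches_le {r : ℝ} (hr : r ∈ Ico (0 : ℝ) 1) (u : ℝ → ℝ) :
    eVariationOn (u ∘ branchZero r) (Icc 0 1) + eVariationOn (u ∘ branchOne r) (Icc 0 1) ≤
      eVariationOn u (Icc 0 1) := by
  have h := eVariationOn.Icc_add_Icc u (s := univ) (a := 0) (b := 1 / 2) (c := (1 : ℝ))
    (by norm_num) (by norm_num) (mem_univ _)
  simp only [univ_inter] at h
  rw [← h]
  refine add_le_add (eVariationOn.comp_le_of_monotoneOn u _ (monotoneOn_branchZero hr) ?_)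
    (eVariationOn.comp_le_of_antitoneOn u _ (antitoneOn_branchOne hr) ?_)
  · exact fun x hx => branchZero_mem_half hr hx
  · intro x hx
    have := branchZero_mem_half hr hx
    rw [branchOne_eq hr hx]
    exact ⟨by linarith [this.2], by linarith [this.1]⟩

/-- Each weight is at most `1 / (2 - r)`, so one step costs this factor, while the variations of `u`
along the two branches together do not exceed that of `u`. The induction therefore runs over all `u`
at once. -/
lemma pairTransfer_variation_le {r : ℝ} (hr : r ∈ Ico (0 : ℝ) 1) (n : ℕ) :
    ∀ u : ℝ → ℝ, BoundedVariationOn u (Icc 0 1) → ∀ x ∈ Icc (0 : ℝ) 1, ∀ y ∈ Icc (0 : ℝ) 1,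
      (pairTransfer r)^[n] (fun a b => |u a - u b|) x y ≤
        (eVariationOn u (Icc 0 1)).toReal * (1 / (2 - r)) ^ n := by
  have hθ := contraction_pos hr
  induction n with
  | zero =>
    intro u hu x hx y hy
    simpa [Real.dist_eq] using hu.dist_le hx hy
  | succ n ih =>
    intro u hu x hx y hy
    have hle := eVariationOn_comp_branches_le hr u
    have hu0 : BoundedVariationOn (u ∘ branchZero r) (Icc 0 1) :=
      ne_top_of_le_ne_top hu (le_self_add.trans hle)
    have hu1 : BoundedVariationOn (u ∘ branchOne r) (Icc 0 1) :=
      ne_top_of_le_ne_top hu (le_add_self.trans hle)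
    have hle' := ENNReal.toReal_mono hu hle
    rw [ENNReal.toReal_add hu0 hu1] at hle'
    rw [Function.iterate_succ_apply]
    have h1 := pairTransfer_mono hr (Φ := pairTransfer r (fun a b => |u a - u b|))
      (Ψ := fun a b => 1 / (2 - r) * (|(u ∘ branchZero r) a - (u ∘ branchZero r) b|
        + |(u ∘ branchOne r) a - (u ∘ branchOne r) b|)) ?_ n x hx y hy
    · rw [pairTransfer_const_mul r _ (fun a b => |(u ∘ branchZero r) a - (u ∘ branchZero r) b|
        + |(u ∘ branchOne r) a - (u ∘ branchOne r) b|), pairTransfer_add r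
        (fun a b => |(u ∘ branchZero r) a - (u ∘ branchZero r) b|)
        (fun a b => |(u ∘ branchOne r) a - (u ∘ branchOne r) b|)] at h1
      refine h1.trans ?_
      rw [pow_succ']
      have h2 := add_le_add (ih _ hu0 x hx y hy) (ih _ hu1 x hx y hy)
      rw [← add_mul] at h2
      have h3 := h2.trans (mul_le_mul_of_nonneg_right hle' (by positivity))
      calc _ ≤ _ := mul_le_mul_of_nonneg_left h3 hθ.le
        _ = _ := by ring
    · intro a ha b hb
      rw [mul_add]
      exact add_le_add (mul_le_mul_of_nonneg_right (probZero_le hr ha) (abs_nonneg _))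
        (mul_le_mul_of_nonneg_right (probOne_le hr ha) (abs_nonneg _))

lemma BoundedVariationOn.exists_abs_le {u : ℝ → ℝ} (hu : BoundedVariationOn u (Icc 0 1)) :
    ∃ B : ℝ, 0 ≤ B ∧ ∀ x ∈ Icc (0 : ℝ) 1, |u x| ≤ B := by
  refine ⟨|u 0| + (eVariationOn u (Icc 0 1)).toReal, by positivity, fun x hx => ?_⟩
  have := hu.dist_le hx (show (0 : ℝ) ∈ Icc 0 1 by simp)
  rw [Real.dist_eq] at this
  have h2 := abs_add_le (u 0) (u x - u 0)
  rw [add_sub_cancel] at h2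
  linarith

lemma hasVanishingOscillation_mul {r : ℝ} (hr : r ∈ Ico (0 : ℝ) 1) {u : ℝ → ℝ}
    (hu : BoundedVariationOn u (Icc 0 1)) :
    HasVanishingOscillation r (fun x => (1 - r + r * x) * u x) := by
  obtain ⟨B, hB0, hB⟩ := hu.exists_abs_le
  have hc : ∀ x ∈ Icc (0 : ℝ) 1, |1 - r + r * x| ≤ 1 := by
    intro x hx
    rw [abs_of_nonneg (by nlinarith [hr.1, hr.2, hx.1])]
    nlinarith [hr.1, hx.2]
  refine ⟨⟨B, hB0, fun x hx => ?_⟩, fun ε hε => ?_⟩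
  · rw [abs_mul]
    nlinarith [hc x hx, hB x hx, abs_nonneg (u x)]
  · filter_upwards [pow_contraction_eventually_le hr
      ((eVariationOn u (Icc 0 1)).toReal + B) hε] with n hn x hx y hy
    have h1 := pairTransfer_mono hr
      (Φ := fun a b => |(1 - r + r * a) * u a - (1 - r + r * b) * u b|)
      (Ψ := fun a b => |u a - u b| + B * |a - b|) ?_ n x hx y hy
    · rw [pairTransfer_add r (fun a b => |u a - u b|) (fun a b => B * |a - b|),
        pairTransfer_const_mul r _ (fun a b => |a - b|)] at h1
      have h2 := pairTransfer_variation_le hr n u hu x hx y hy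
      have h3 := mul_le_mul_of_nonneg_left (pairTransfer_abs_sub_le hr n x hx y hy) hB0
      rw [add_mul] at hn
      linarith
    · intro a ha b hb
      have e : (1 - r + r * a) * u a - (1 - r + r * b) * u b =
          (1 - r + r * a) * (u a - u b) + r * u b * (a - b) := by ring
      rw [e]
      refine (abs_add_le _ _).trans (add_le_add ?_ ?_)
      · rw [abs_mul]
        exact mul_le_of_le_one_left (abs_nonneg _) (hc a ha)
      · rw [abs_mul, abs_mul, abs_of_nonneg hr.1]
        refine mul_le_mul_of_nonneg_right ?_ (abs_nonneg _)
        nlinarith [hB b hb, abs_nonneg (u b), hr.1, hr.2]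

/-! ### Invariant density and convergence for bounded variation -/

lemma density_denom_pos {r x : ℝ} (hr : r ∈ Ico (0 : ℝ) 1) (hx : x ∈ Icc (0 : ℝ) 1) :
    0 < 1 - r + r * x := by linarith [branch_denom_gt_one hr hx]

lemma density_denom_branchZero {r x : ℝ} (hr : r ∈ Ico (0 : ℝ) 1) (hx : x ∈ Icc (0 : ℝ) 1) :
    1 - r + r * branchZero r x = (2 - r) * (1 - r + r * x) / (2 - r + r * x) := by
  have h := branch_denom_pos hr hx
  rw [eq_div_iff h.ne', branchZero, add_mul, mul_assoc, div_mul_cancel₀ _ h.ne']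
  ring

lemma density_denom_branchOne {r x : ℝ} (hr : r ∈ Ico (0 : ℝ) 1) (hx : x ∈ Icc (0 : ℝ) 1) :
    1 - r + r * branchOne r x = (2 - r) / (2 - r + r * x) := by
  have h := branch_denom_pos hr hx
  rw [eq_div_iff h.ne', branchOne, add_mul, mul_assoc, div_mul_cancel₀ _ h.ne']
  ring

/-- The conjugation by the density, which transfers the convergence to a constant into convergence
to a multiple of the density. -/
lemma realTransfer_iterate {r : ℝ} (hr : r ∈ Ico (0 : ℝ) 1) (u : ℝ → ℝ) (n : ℕ) :
    ∀ x ∈ Icc (0 : ℝ) 1, (realTransfer r)^[n] u x =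
      (normalizedTransfer r)^[n] (fun a => (1 - r + r * a) * u a) x / (1 - r + r * x) := by
  induction n with
  | zero =>
    intro x hx
    exact (mul_div_cancel_left₀ _ (density_denom_pos hr hx).ne').symm
  | succ n ih =>
    intro x hx
    simp only [Function.iterate_succ_apply']
    simp only [realTransfer, normalizedTransfer]
    rw [ih _ (branchZero_mem hr hx), ih _ (branchOne_mem hr hx), density_denom_branchZero hr hx,
      density_denom_branchOne hr hx]
    have h1 := branch_denom_pos hr hx
    have h2 := density_denom_pos hr hx
    have h3 : 0 < 2 - r := by linarith [hr.2]
    simp only [branchWeight, probZero, probOne]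
    generalize (normalizedTransfer r)^[n] _ (branchZero r x) = A
    generalize (normalizedTransfer r)^[n] _ (branchOne r x) = C
    generalize 2 - r + r * x = d at *
    generalize 1 - r + r * x = e at *
    field_simp

lemma injOn_branchZero {r : ℝ} (hr : r ∈ Ico (0 : ℝ) 1) : InjOn (branchZero r) (Icc 0 1) := by
  intro x hx y hy hxy
  have h := branchZero_sub hr hx hy
  have := branch_denom_pos hr hx
  have := branch_denom_pos hr hy
  have h3 : 0 < 2 - r := by linarith [hr.2]
  rw [hxy, sub_self, eq_comm, mul_eq_zero] at h
  rcases h with h | h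
  · exact absurd h (by positivity)
  · linarith

lemma injOn_branchOne {r : ℝ} (hr : r ∈ Ico (0 : ℝ) 1) : InjOn (branchOne r) (Icc 0 1) := by
  intro x hx y hy hxy
  rw [branchOne_eq hr hx, branchOne_eq hr hy] at hxy
  exact injOn_branchZero hr hx hy (by linarith)

lemma image_branchZero {r : ℝ} (hr : r ∈ Ico (0 : ℝ) 1) :
    branchZero r '' Icc 0 1 = Icc 0 (1 / 2) := by
  refine Subset.antisymm (image_subset_iff.2 fun x hx => branchZero_mem_half hr hx) ?_
  exact fun y hy => ⟨markovMap r y, markovMap_mem_of_le hr hy, branchZero_markovMap hr hy⟩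

lemma image_branchOne {r : ℝ} (hr : r ∈ Ico (0 : ℝ) 1) :
    branchOne r '' Icc 0 1 = Icc (1 / 2) 1 := by
  refine Subset.antisymm (image_subset_iff.2 fun x hx => ?_) fun y hy =>
    ⟨markovMap r y, markovMap_mem hr ⟨by linarith [hy.1], hy.2⟩, branchOne_markovMap hr hy⟩
  have := branchZero_mem_half hr hx
  rw [mem_preimage, branchOne_eq hr hx]
  exact ⟨by linarith [this.2], by linarith [this.1]⟩

lemma integrableOn_realTransfer {r : ℝ} (hr : r ∈ Ico (0 : ℝ) 1) {u : ℝ → ℝ}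
    (hu : IntegrableOn u (Icc 0 1)) :
    IntegrableOn (realTransfer r u) (Icc 0 1) ∧
      ∫ x in Icc (0 : ℝ) 1, realTransfer r u x = ∫ x in Icc (0 : ℝ) 1, u x := by
  have hu0 : IntegrableOn u (Icc 0 (1 / 2)) := hu.mono_set (Icc_subset_Icc_right (by norm_num))
  have hu1 : IntegrableOn u (Icc (1 / 2) 1) := hu.mono_set (Icc_subset_Icc_left (by norm_num))
  have d0 := fun x (hx : x ∈ Icc (0 : ℝ) 1) =>
    (hasDerivAt_branchZero hr hx).hasDerivWithinAt (s := Icc 0 1)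
  have d1 := fun x (hx : x ∈ Icc (0 : ℝ) 1) =>
    (hasDerivAt_branchOne hr hx).hasDerivWithinAt (s := Icc 0 1)
  have i0 := (integrableOn_image_iff_integrableOn_abs_deriv_smul measurableSet_Icc d0
    (injOn_branchZero hr) u).1 (by rwa [image_branchZero hr])
  have i1 := (integrableOn_image_iff_integrableOn_abs_deriv_smul measurableSet_Icc d1
    (injOn_branchOne hr) u).1 (by rwa [image_branchOne hr])
  have e0 := integral_image_eq_integral_abs_deriv_smul measurableSet_Icc d0
    (injOn_branchZero hr) u
  have e1 := integral_image_eq_integral_abs_deriv_smul measurableSet_Icc d1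
    (injOn_branchOne hr) u
  rw [image_branchZero hr] at e0
  rw [image_branchOne hr] at e1
  have heq : EqOn (fun x => |branchWeight r x| • u (branchZero r x)
      + |-branchWeight r x| • u (branchOne r x)) (realTransfer r u) (Icc 0 1) := by
    intro x hx
    simp only [abs_neg, abs_of_pos (branchWeight_pos hr hx), smul_eq_mul, realTransfer]
    ring
  refine ⟨(i0.add i1).congr_fun heq measurableSet_Icc, ?_⟩
  rw [← setIntegral_congr_fun measurableSet_Icc heq, integral_add i0 i1, ← e0, ← e1]
  rw [integral_Icc_eq_integral_Ioc (x := (1 / 2 : ℝ)), ← setIntegral_union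
    (disjoint_left.2 fun x h1 h2 => not_lt.2 h1.2 h2.1) measurableSet_Ioc hu0
    (hu1.mono_set Ioc_subset_Icc_self), Icc_union_Ioc_eq_Icc (by norm_num) (by norm_num)]

lemma integrableOn_realTransfer_iterate {r : ℝ} (hr : r ∈ Ico (0 : ℝ) 1) {u : ℝ → ℝ}
    (hu : IntegrableOn u (Icc 0 1)) (n : ℕ) :
    IntegrableOn ((realTransfer r)^[n] u) (Icc 0 1) ∧
      ∫ x in Icc (0 : ℝ) 1, (realTransfer r)^[n] u x = ∫ x in Icc (0 : ℝ) 1, u x := by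
  induction n with
  | zero => exact ⟨hu, rfl⟩
  | succ n ih =>
    rw [Function.iterate_succ_apply']
    have := integrableOn_realTransfer hr ih.1
    exact ⟨this.1, this.2.trans ih.2⟩

lemma integrableOn_one_div_density_denom {r : ℝ} (hr : r ∈ Ico (0 : ℝ) 1) :
    IntegrableOn (fun x => 1 / (1 - r + r * x)) (Icc 0 1) := by
  refine ContinuousOn.integrableOn_compact isCompact_Icc ?_
  exact continuousOn_const.div (by fun_prop) fun x hx => (density_denom_pos hr hx).ne'

lemma invDensity_eq {r : ℝ} (hr : r ∈ Ico (0 : ℝ) 1) {x : ℝ} (hx : x ∈ Icc (0 : ℝ) 1) :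
    0 < ∫ t in Icc (0 : ℝ) 1, 1 / (1 - r + r * t) ∧
    invDensity r x =
      1 / (1 - r + r * x) / ∫ t in Icc (0 : ℝ) 1, 1 / (1 - r + r * t) := by
  rcases hr.1.eq_or_lt with h | h
  · subst h
    simp [invDensity]
  · have h1 : 0 < 1 - r := by linarith [hr.2]
    have hlog : Real.log (1 - r) < 0 := Real.log_neg h1 (by linarith)
    have hint : ∫ t in Icc (0 : ℝ) 1, 1 / (1 - r + r * t) = -Real.log (1 - r) / r := by
      rw [integral_Icc_eq_integral_Ioc, ← intervalIntegral.integral_of_le zero_le_one]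
      have hd : ∀ t ∈ uIcc (0 : ℝ) 1,
          HasDerivAt (fun t => Real.log (1 - r + r * t) / r) (1 / (1 - r + r * t)) t := by
        intro t ht
        rw [uIcc_of_le zero_le_one] at ht
        have hp := density_denom_pos hr ht
        have h2 : HasDerivAt (fun t => 1 - r + r * t) r t := by
          simpa using ((hasDerivAt_id t).const_mul r).const_add (1 - r)
        convert! (h2.log hp.ne').div_const r using 1
        field_simp
      rw [intervalIntegral.integral_eq_sub_of_hasDerivAt hd]
      · simp
        ring
      · refine ContinuousOn.intervalIntegrable ?_
        rw [uIcc_of_le zero_le_one]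
        exact continuousOn_const.div (by fun_prop) fun x hx => (density_denom_pos hr hx).ne'
    rw [hint]
    refine ⟨div_pos (by linarith) h, ?_⟩
    rw [invDensity, if_neg h.ne', if_neg hr.2.ne]
    have hp := density_denom_pos hr hx
    generalize 1 - r + r * x = e at *
    have := hlog.ne
    field_simp

/-- The iterates of the Perron-Frobenius operator on a function of bounded variation converge
uniformly to its integral times the invariant density. -/
lemma realTransfer_tendsto {r : ℝ} (hr : r ∈ Ico (0 : ℝ) 1) {u : ℝ → ℝ}
    (hu : BoundedVariationOn u (Icc 0 1)) (hint : IntegrableOn u (Icc 0 1)) {ε : ℝ} (hε : 0 < ε) :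
    ∀ᶠ n : ℕ in atTop, ∀ x ∈ Icc (0 : ℝ) 1,
      |(realTransfer r)^[n] u x - (∫ t in Icc (0 : ℝ) 1, u t) * invDensity r x| ≤ ε := by
  obtain ⟨a, ha⟩ := (hasVanishingOscillation_mul hr hu).exists_limit hr
  have h1 : 0 < 1 - r := by linarith [hr.2]
  have hlim : ∀ ε : ℝ, 0 < ε → ∀ᶠ n : ℕ in atTop, ∀ x ∈ Icc (0 : ℝ) 1,
      |(realTransfer r)^[n] u x - a * (1 / (1 - r + r * x))| ≤ ε := by
    intro ε hε
    filter_upwards [ha (ε * (1 - r)) (by positivity)] with n hn x hx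
    have hp := density_denom_pos hr hx
    rw [realTransfer_iterate hr u n x hx, mul_one_div, ← sub_div, abs_div, abs_of_pos hp,
      div_le_iff₀ hp]
    refine (hn x hx).trans (mul_le_mul_of_nonneg_left ?_ hε.le)
    nlinarith [hr.1, hx.1]
  have hI := integrableOn_one_div_density_denom hr
  -- The integral is the same for all iterates and the interval has length one, so uniform closeness
  -- to `a / (1 - r + r * x)` determines `a`.
  have heq : ∫ t in Icc (0 : ℝ) 1, u t = a * ∫ t in Icc (0 : ℝ) 1, 1 / (1 - r + r * t) := by
    refine eq_of_abs_sub_le_all fun δ hδ => ?_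
    obtain ⟨n, hn⟩ := (hlim δ hδ).exists
    obtain ⟨i1, i2⟩ := integrableOn_realTransfer_iterate hr hint n
    rw [← i2, ← integral_const_mul, ← integral_sub i1 (hI.const_mul a)]
    have := norm_setIntegral_le_of_norm_le_const (μ := volume) (s := Icc (0 : ℝ) 1) (C := δ)
      (f := fun x => (realTransfer r)^[n] u x - a * (1 / (1 - r + r * x)))
      (by simp) (fun x hx => hn x hx)
    simpa using this
  filter_upwards [hlim ε hε] with n hn x hx
  obtain ⟨hpos, hd⟩ := invDensity_eq hr hx
  rw [heq, hd, mul_assoc, mul_div_cancel₀ _ hpos.ne']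
  exact hn x hx

/-! ### Singular kernels -/

/-- The Perron-Frobenius operator on functions with values in the extended nonnegative reals. -/
def ennTransfer (r : ℝ) (s : ℝ → ENNReal) : ℝ → ENNReal := fun x =>
  ENNReal.ofReal (branchWeight r x) * (s (branchZero r x) + s (branchOne r x))

/-- The kernel `|b - x| ^ (-a)` with values in the extended nonnegative reals. -/
def singKernel (a b x : ℝ) : ENNReal := ENNReal.ofReal |b - x| ^ (-a)

lemma ennTransfer_mono {r : ℝ} (hr : r ∈ Ico (0 : ℝ) 1) {s t : ℝ → ENNReal}
    (h : ∀ x ∈ Icc (0 : ℝ) 1, s x ≤ t x) (n : ℕ) :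
    ∀ x ∈ Icc (0 : ℝ) 1, (ennTransfer r)^[n] s x ≤ (ennTransfer r)^[n] t x := by
  induction n with
  | zero => exact h
  | succ n ih =>
    intro x hx
    simp only [Function.iterate_succ_apply']
    simp only [ennTransfer]
    gcongr
    · exact ih _ (branchZero_mem hr hx)
    · exact ih _ (branchOne_mem hr hx)

lemma ennTransfer_add (r : ℝ) (s t : ℝ → ENNReal) (n : ℕ) : ∀ x,
    (ennTransfer r)^[n] (fun x => s x + t x) x =
      (ennTransfer r)^[n] s x + (ennTransfer r)^[n] t x := by
  induction n with
  | zero => intro x; rfl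
  | succ n ih =>
    intro x
    simp only [Function.iterate_succ_apply']
    simp only [ennTransfer, ih]
    ring

lemma ennTransfer_const_mul (r : ℝ) (c : ENNReal) (s : ℝ → ENNReal) (n : ℕ) : ∀ x,
    (ennTransfer r)^[n] (fun x => c * s x) x = c * (ennTransfer r)^[n] s x := by
  induction n with
  | zero => intro x; rfl
  | succ n ih =>
    intro x
    simp only [Function.iterate_succ_apply']
    simp only [ennTransfer, ih]
    ring

lemma realTransfer_density {r x : ℝ} (hr : r ∈ Ico (0 : ℝ) 1) (hx : x ∈ Icc (0 : ℝ) 1) :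
    realTransfer r (fun t => 1 / (1 - r + r * t)) x = 1 / (1 - r + r * x) := by
  have h2 := density_denom_pos hr hx
  have h3 : 0 < 2 - r := by linarith [hr.2]
  have hd : 2 - r + r * x = 1 + (1 - r + r * x) := by ring
  simp only [realTransfer, branchWeight]
  rw [density_denom_branchZero hr hx, density_denom_branchOne hr hx, hd]
  generalize 1 - r + r * x = e at *
  generalize 2 - r = d at *
  field_simp

/-- The constant `1` is dominated by the invariant function `1 / (1 - r + r * x)`, which is at most
`1 / (1 - r)`. -/
lemma ennTransfer_one_le {r : ℝ} (hr : r ∈ Ico (0 : ℝ) 1) (n : ℕ) :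
    ∀ x ∈ Icc (0 : ℝ) 1, (ennTransfer r)^[n] (fun _ => 1) x ≤ ENNReal.ofReal (1 / (1 - r)) := by
  have h1 : 0 < 1 - r := by linarith [hr.2]
  have hk : ∀ x ∈ Icc (0 : ℝ) 1, (ennTransfer r)^[n]
      (fun t => ENNReal.ofReal (1 / (1 - r + r * t))) x =
        ENNReal.ofReal (1 / (1 - r + r * x)) := by
    induction n with
    | zero => intro x _; rfl
    | succ n ih =>
      intro x hx
      rw [Function.iterate_succ_apply', ennTransfer, ih _ (branchZero_mem hr hx),
        ih _ (branchOne_mem hr hx), ← ENNReal.ofReal_add, ← ENNReal.ofReal_mul]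
      · exact congrArg _ (realTransfer_density hr hx)
      · exact (branchWeight_pos hr hx).le
      · exact (one_div_pos.2 (density_denom_pos hr (branchZero_mem hr hx))).le
      · exact (one_div_pos.2 (density_denom_pos hr (branchOne_mem hr hx))).le
  intro x hx
  calc _ ≤ _ := ennTransfer_mono hr (t := fun t => ENNReal.ofReal (1 / (1 - r + r * t))) (by
        intro t ht
        rw [← ENNReal.ofReal_one]
        refine ENNReal.ofReal_le_ofReal ?_
        rw [le_div_iff₀ (density_denom_pos hr ht)]
        nlinarith [hr.1, ht.2]) n x hx
    _ = _ := hk x hx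
    _ ≤ _ := by
        refine ENNReal.ofReal_le_ofReal (one_div_le_one_div_of_le h1 ?_)
        nlinarith [hr.1, hx.1]

/-- The Jacobian `w` meets a distance contracted by roughly `w`, and `w * w ^ (-a) = w ^ (1 - a)`
stays below `(1 / (2 - r)) ^ (1 - a)`. The variation of the derivative between `b` and `x` costs
only an additive constant, which keeps the multiplicative factor below one. -/
lemma branchWeight_mul_rpow_le {r a b x : ℝ} (hr : r ∈ Ico (0 : ℝ) 1) (ha : a ∈ Ioo (0 : ℝ) 1)
    (hb : b ∈ Icc (0 : ℝ) 1) (hx : x ∈ Icc (0 : ℝ) 1) (hbx : b ≠ x) :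
    branchWeight r x * |branchZero r b - branchZero r x| ^ (-a) ≤
      (1 / (2 - r)) ^ (1 - a) * (|b - x| ^ (-a) + 1) := by
  have ht : 0 < |b - x| := abs_pos.2 (sub_ne_zero.2 hbx)
  have hw := branchWeight_pos hr hx
  have hdb := branch_denom_gt_one hr hb
  have hdx := branch_denom_gt_one hr hx
  have h2 : 0 < 2 - r := by linarith [hr.2]
  have hlow : branchWeight r x * (|b - x| / (1 + |b - x|)) ≤
      |branchZero r b - branchZero r x| := by
    rw [abs_branchZero_sub hr hb hx, branchWeight]
    have h5 : r * (b - x) ≤ |b - x| := by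
      nlinarith [le_abs_self (b - x), abs_nonneg (b - x), hr.1, hr.2]
    have h6 : 2 - r + r * b ≤ (2 - r + r * x) * (1 + |b - x|) := by nlinarith
    rw [div_mul_div_comm, div_mul_eq_mul_div]
    refine div_le_div_of_nonneg_left (by positivity) (by positivity) ?_
    nlinarith
  have hpos : 0 < branchWeight r x * (|b - x| / (1 + |b - x|)) := by positivity
  have e1 := Real.rpow_le_rpow_of_nonpos hpos hlow (by linarith [ha.1] : -a ≤ 0)
  -- With `t = |b - x|` the left side is `(1 / t + 1) ^ a`, and powers with exponent at most one are
  -- subadditive.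
  have e2 : (|b - x| / (1 + |b - x|)) ^ (-a) ≤ |b - x| ^ (-a) + 1 := by
    rw [Real.rpow_neg (by positivity), ← Real.inv_rpow (by positivity), inv_div, add_div,
      div_self ht.ne', Real.rpow_neg ht.le, ← Real.inv_rpow ht.le, one_div]
    simpa using Real.rpow_add_le_add_rpow (inv_nonneg.2 ht.le) zero_le_one ha.1.le ha.2.le
  calc _ ≤ _ := mul_le_mul_of_nonneg_left e1 hw.le
    _ = branchWeight r x ^ (1 - a) * (|b - x| / (1 + |b - x|)) ^ (-a) := by
        rw [Real.mul_rpow hw.le (by positivity), ← mul_assoc, show 1 - a = 1 + -a by ring,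
          Real.rpow_add hw, Real.rpow_one]
    _ ≤ _ := by
        refine mul_le_mul (Real.rpow_le_rpow hw.le (branchWeight_le hr hx)
          (by linarith [ha.2])) e2 (by positivity) (by positivity)

lemma branchWeight_mul_singKernel_le {r a b x : ℝ} (hr : r ∈ Ico (0 : ℝ) 1)
    (ha : a ∈ Ioo (0 : ℝ) 1) (hb : b ∈ Icc (0 : ℝ) 1) (hx : x ∈ Icc (0 : ℝ) 1) :
    ENNReal.ofReal (branchWeight r x) * singKernel a (branchZero r b) (branchZero r x) ≤
      ENNReal.ofReal ((1 / (2 - r)) ^ (1 - a)) * singKernel a b x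
        + ENNReal.ofReal ((1 / (2 - r)) ^ (1 - a)) := by
  have hθ := contraction_pos hr
  have hκ : 0 < (1 / (2 - r)) ^ (1 - a) := by positivity
  by_cases hbx : b = x
  · subst hbx
    have : singKernel a b b = ⊤ := by
      simp [singKernel, ENNReal.zero_rpow_of_neg, ha.1]
    rw [this, ENNReal.mul_top (by simpa using hκ)]
    simp
  · have ht : 0 < |b - x| := abs_pos.2 (sub_ne_zero.2 hbx)
    have ht' : 0 < |branchZero r b - branchZero r x| :=
      abs_pos.2 (sub_ne_zero.2 fun h => hbx (injOn_branchZero hr hb hx h))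
    have h := branchWeight_mul_rpow_le hr ha hb hx hbx
    unfold singKernel
    rw [ENNReal.ofReal_rpow_of_pos ht, ENNReal.ofReal_rpow_of_pos ht',
      ← ENNReal.ofReal_mul (branchWeight_pos hr hx).le, ← ENNReal.ofReal_mul hκ.le,
      ← ENNReal.ofReal_add (by positivity) hκ.le]
    refine ENNReal.ofReal_le_ofReal ?_
    linarith

lemma singKernel_anti {a b x b' x' : ℝ} (ha : 0 < a) (h : |b' - x'| ≤ |b - x|) :
    singKernel a b x ≤ singKernel a b' x' := by
  unfold singKernel
  rw [ENNReal.rpow_neg, ENNReal.rpow_neg]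
  gcongr

lemma ennTransfer_singKernel_one_sub {r a b x : ℝ} (hr : r ∈ Ico (0 : ℝ) 1)
    (hx : x ∈ Icc (0 : ℝ) 1) :
    ennTransfer r (singKernel a (1 - b)) x = ennTransfer r (singKernel a b) x := by
  have h0 : |1 - b - branchZero r x| = |b - (1 - branchZero r x)| := by
    rw [abs_sub_comm]
    congr 1
    ring
  have h1 : |1 - b - (1 - branchZero r x)| = |b - branchZero r x| := by
    rw [abs_sub_comm]
    congr 1
    ring
  unfold ennTransfer singKernel
  rw [branchOne_eq hr hx, h0, h1, add_comm]

/-- By reflection let `b ≤ 1/2`, so that `b` is the increasing preimage of its image and that branch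
carries the pole. The other preimage of `x` lies in `[1/2, 1]`: if `b` is at least `η` away from
`1/2`, its term is bounded by `η ^ (-a)`; otherwise it is no closer to `b` than the first preimage,
and its term is at most the first. -/
lemma ennTransfer_singKernel_le {r a b x η : ℝ} (hr : r ∈ Ico (0 : ℝ) 1)
    (ha : a ∈ Ioo (0 : ℝ) 1) (hb : b ∈ Icc (0 : ℝ) 1) (hx : x ∈ Icc (0 : ℝ) 1) (hη : 0 < η) :
    ennTransfer r (singKernel a b) x ≤
      ENNReal.ofReal ((if |b - 1 / 2| < η then 2 else 1) * (1 / (2 - r)) ^ (1 - a)) *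
        singKernel a (markovMap r b) x
      + ENNReal.ofReal (2 * (1 / (2 - r)) ^ (1 - a) + η ^ (-a)) := by
  wlog hb2 : b ≤ 1 / 2 generalizing b
  · have h := this (b := 1 - b) ⟨by linarith [hb.2], by linarith [hb.1]⟩
      (by linarith [not_le.1 hb2])
    rw [markovMap_one_sub hr hb, ennTransfer_singKernel_one_sub hr hx, abs_sub_comm,
      show (1 / 2 - (1 - b) : ℝ) = b - 1 / 2 by ring] at h
    exact h
  have hκ : 0 < (1 / (2 - r)) ^ (1 - a) := by
    have := contraction_pos hr
    positivity
  have hηa : 0 < η ^ (-a) := by positivity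
  have hT := markovMap_mem hr hb
  have near := branchWeight_mul_singKernel_le hr ha hT hx
  rw [branchZero_markovMap hr ⟨hb.1, hb2⟩] at near
  have hx0 := branchZero_mem_half hr hx
  have hfar : |b - branchOne r x| = 1 - branchZero r x - b := by
    rw [branchOne_eq hr hx, abs_sub_comm, abs_of_nonneg (by linarith [hx0.2])]
  unfold ennTransfer
  rw [mul_add]
  split_ifs with hc
  · have h1 : singKernel a b (branchOne r x) ≤ singKernel a b (branchZero r x) := by
      refine singKernel_anti ha.1 ?_
      rw [hfar]
      exact abs_le.2 ⟨by linarith [hb.1, hx0.2], by linarith [hx0.1, hx0.2]⟩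
    calc _ ≤ _ := add_le_add near ((mul_le_mul_right h1 _).trans near)
      _ = ENNReal.ofReal (2 * (1 / (2 - r)) ^ (1 - a)) * singKernel a (markovMap r b) x +
          ENNReal.ofReal (2 * (1 / (2 - r)) ^ (1 - a)) := by
          rw [ENNReal.ofReal_mul zero_le_two, ENNReal.ofReal_ofNat]
          ring
      _ ≤ _ := by
          gcongr
          linarith
  · have h1 : ENNReal.ofReal (branchWeight r x) * singKernel a b (branchOne r x) ≤
        ENNReal.ofReal (η ^ (-a)) := by
      have hw : ENNReal.ofReal (branchWeight r x) ≤ 1 := by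
        rw [← ENNReal.ofReal_one]
        exact ENNReal.ofReal_le_ofReal
          ((branchWeight_le hr hx).trans (contraction_lt_one hr).le)
      refine (mul_le_of_le_one_left' hw).trans ?_
      have h2 : η ≤ |b - branchOne r x| := by
        rw [not_lt, abs_sub_comm, abs_of_nonneg (by linarith)] at hc
        rw [hfar]
        linarith [hx0.2]
      have h3 : singKernel a b (branchOne r x) ≤ singKernel a 0 η :=
        singKernel_anti ha.1 (by rwa [zero_sub, abs_neg, abs_of_pos hη])
      refine h3.trans (le_of_eq ?_)
      rw [singKernel, zero_sub, abs_neg, abs_of_pos hη, ENNReal.ofReal_rpow_of_pos hη]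
    calc _ ≤ _ := add_le_add near h1
      _ = ENNReal.ofReal (1 * (1 / (2 - r)) ^ (1 - a)) * singKernel a (markovMap r b) x +
          ENNReal.ofReal ((1 / (2 - r)) ^ (1 - a) + η ^ (-a)) := by
          rw [one_mul, ENNReal.ofReal_add hκ.le hηa.le, add_assoc]
      _ ≤ _ := by
          gcongr
          linarith

/-- A function that compensates for the factor `2` picked up near the folding point `1/2`. -/
lemma exists_folding_weight {r κ : ℝ} (hr : r ∈ Ico (0 : ℝ) 1) (hκ : κ ∈ Ioo (0 : ℝ) 1) :
    ∃ ρ ∈ Ioo (0 : ℝ) 1, ∃ η : ℝ, 0 < η ∧ ∃ ψ : ℝ → ℝ,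
      (∀ b ∈ Icc (0 : ℝ) 1, 1 ≤ ψ b ∧ ψ b ≤ 9) ∧
      ∀ b ∈ Icc (0 : ℝ) 1,
        (if |b - 1 / 2| < η then 2 else 1) * κ * ψ (markovMap r b) ≤ ρ * ψ b := by
  -- The exponent is so small that a factor `2 ^ γ` per step still leaves a contraction.
  obtain ⟨γ, hγ1, hγ0, hγκ⟩ : ∃ γ : ℝ, γ < 1 ∧ 0 < γ ∧ (2 : ℝ) ^ γ * κ < 1 := by
    have hc : ContinuousAt (fun γ : ℝ => (2 : ℝ) ^ γ * κ) 0 :=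
      ((Real.continuous_const_rpow two_ne_zero).mul continuous_const).continuousAt
    have h1 : ∀ᶠ γ : ℝ in 𝓝 0, (2 : ℝ) ^ γ * κ < 1 :=
      hc.eventually_lt_const (by simpa using hκ.2)
    have h2 : ∀ᶠ γ : ℝ in 𝓝[>] 0, γ < 1 ∧ 0 < γ ∧ (2 : ℝ) ^ γ * κ < 1 := by
      filter_upwards [h1.filter_mono nhdsWithin_le_nhds, self_mem_nhdsWithin,
        (eventually_lt_nhds zero_lt_one).filter_mono nhdsWithin_le_nhds] with γ h1 h2 h3
      exact ⟨h3, h2, h1⟩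
    exact h2.exists
  have h2γ : 1 ≤ (2 : ℝ) ^ γ := Real.one_le_rpow one_le_two hγ0.le
  -- Chosen so that `ε ^ γ = 1 / 16`: if `b` is within `ε / 4` of `1/2`, its image is within `ε` of
  -- `1`, where `ψ ≤ 3 / 2`, while `ψ b ≥ 3`. This ratio pays for the factor `2`.
  set ε : ℝ := (1 / 16) ^ (1 / γ) with hε
  have hε0 : 0 < ε := by positivity
  have hε1 : ε ≤ 1 / 16 := by
    have : (1 / 16 : ℝ) ^ (1 / γ) ≤ (1 / 16) ^ (1 : ℝ) :=
      Real.rpow_le_rpow_of_exponent_ge (by norm_num) (by norm_num)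
        ((one_le_div hγ0).2 hγ1.le)
    rwa [Real.rpow_one] at this
  have hεγ : ε ^ γ = 1 / 16 := by
    rw [hε, ← Real.rpow_mul (by norm_num), one_div_mul_cancel hγ0.ne', Real.rpow_one]
  have hm : ∀ b ∈ Icc (0 : ℝ) 1, 0 ≤ min b (1 - b) := fun b hb =>
    le_min hb.1 (by linarith [hb.2])
  refine ⟨2 ^ γ * κ, ⟨mul_pos (by positivity) hκ.1, hγκ⟩, ε / 4, by positivity,
    fun b => 1 + 8 * min b (1 - b) ^ γ, fun b hb => ⟨?_, ?_⟩, fun b hb => ?_⟩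
  · have := Real.rpow_nonneg (hm b hb) γ
    linarith
  · have := Real.rpow_le_one (hm b hb) ((min_le_left _ _).trans hb.2) hγ0.le
    linarith
  · wlog hb2 : b ≤ 1 / 2 generalizing b
    · have h := this (1 - b) ⟨by linarith [hb.2], by linarith [hb.1]⟩
        (by linarith [not_le.1 hb2])
      rw [markovMap_one_sub hr hb, abs_sub_comm,
        show (1 / 2 - (1 - b) : ℝ) = b - 1 / 2 by ring] at h
      simp only [sub_sub_cancel, min_comm (1 - b)] at h ⊢
      exact h
    have hT := markovMap_mem hr hb
    have hmb : min b (1 - b) = b := min_eq_left (by linarith)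
    simp only [hmb]
    split_ifs with hc
    · rw [abs_sub_comm, abs_of_nonneg (by linarith)] at hc
      have h1 : min (markovMap r b) (1 - markovMap r b) ≤ ε :=
        (min_le_right _ _).trans ((one_sub_markovMap_le hr ⟨hb.1, hb2⟩).trans (by linarith))
      have h2 := Real.rpow_le_rpow (hm _ hT) h1 hγ0.le
      rw [hεγ] at h2
      have h3 : (1 / 4 : ℝ) ≤ b ^ γ := by
        calc (1 / 4 : ℝ) = (1 / 4) ^ (1 : ℝ) := by simp
          _ ≤ (1 / 4) ^ γ :=
            Real.rpow_le_rpow_of_exponent_ge (by norm_num) (by norm_num) hγ1.le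
          _ ≤ b ^ γ := Real.rpow_le_rpow (by norm_num) (by linarith) hγ0.le
      calc _ ≤ 2 * κ * (1 + 8 * (1 / 16)) :=
            mul_le_mul_of_nonneg_left (by linarith) (by linarith [hκ.1])
        _ = 1 * κ * 3 := by ring
        _ ≤ _ := mul_le_mul (mul_le_mul_of_nonneg_right h2γ hκ.1.le) (by linarith)
            (by norm_num) (mul_nonneg (by positivity) hκ.1.le)
    -- Away from the fold the distance to the endpoints at most doubles, so `ψ` grows by at most `2
    -- ^ γ`.
    · have h1 : min (markovMap r b) (1 - markovMap r b) ≤ 2 * b :=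
        (min_le_left _ _).trans (markovMap_le_two_mul hr ⟨hb.1, hb2⟩)
      have h2 := Real.rpow_le_rpow (hm _ hT) h1 hγ0.le
      rw [Real.mul_rpow zero_le_two hb.1] at h2
      have h3 : 1 + 8 * min (markovMap r b) (1 - markovMap r b) ^ γ ≤
          2 ^ γ * (1 + 8 * b ^ γ) := by linarith
      calc _ ≤ _ := mul_le_mul_of_nonneg_left h3 (by linarith [hκ.1])
        _ = _ := by ring

/-- The iterates of the Perron-Frobenius operator on a singular kernel: the singularity moves
along the orbit and decays geometrically, and the rest remains bounded. -/
lemma exists_ennTransfer_iterate_singKernel_le {r a : ℝ} (hr : r ∈ Ico (0 : ℝ) 1)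
    (ha : a ∈ Ioo (0 : ℝ) 1) : ∃ ρ ∈ Ioo (0 : ℝ) 1, ∃ C : ℝ, 0 < C ∧
      ∀ n : ℕ, ∀ b ∈ Icc (0 : ℝ) 1, ∀ x ∈ Icc (0 : ℝ) 1,
        (ennTransfer r)^[n] (singKernel a b) x ≤ ENNReal.ofReal C *
          (ENNReal.ofReal ρ ^ n * singKernel a ((markovMap r)^[n] b) x + 1) := by
  have hθ := contraction_pos hr
  have h1r : 0 < 1 - r := by linarith [hr.2]
  have hκ : (1 / (2 - r)) ^ (1 - a) ∈ Ioo (0 : ℝ) 1 := ⟨by positivity,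
    Real.rpow_lt_one hθ.le (contraction_lt_one hr) (by linarith [ha.2])⟩
  obtain ⟨ρ, hρ, η, hη, ψ, hψ, hψT⟩ := exists_folding_weight hr hκ
  have hρ1 : 0 < 1 - ρ := by linarith [hρ.2]
  set κ := (1 / (2 - r)) ^ (1 - a) with hκdef
  set B := 2 * κ + η ^ (-a) with hB
  have hB0 : 0 < B := by have := hκ.1; positivity
  -- The fixed point of `K ↦ ρ * K + B / (1 - r)`, which bounds the accumulated additive errors.
  set K := B * (1 / (1 - r)) / (1 - ρ) with hK
  have hK0 : 0 < K := by positivity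
  have hKeq : ρ * K + B * (1 / (1 - r)) = K := by
    have : K * (1 - ρ) = B * (1 / (1 - r)) := div_mul_cancel₀ _ hρ1.ne'
    linarith
  have main : ∀ n : ℕ, ∀ b ∈ Icc (0 : ℝ) 1, ∀ x ∈ Icc (0 : ℝ) 1,
      (ennTransfer r)^[n] (singKernel a b) x ≤ ENNReal.ofReal (ψ b) *
        (ENNReal.ofReal ρ ^ n * singKernel a ((markovMap r)^[n] b) x + ENNReal.ofReal K) := by
    intro n
    induction n with
    | zero =>
      intro b hb x _
      have h1 : 1 ≤ ENNReal.ofReal (ψ b) := by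
        rw [← ENNReal.ofReal_one]; exact ENNReal.ofReal_le_ofReal (hψ b hb).1
      simp only [Function.iterate_zero, id, pow_zero, one_mul]
      exact le_self_add.trans (le_mul_of_one_le_left' h1)
    | succ n ih =>
      intro b hb x hx
      have hT := markovMap_mem hr hb
      set c : ℝ := if |b - 1 / 2| < η then 2 else 1 with hc
      have hc0 : 0 ≤ c := by rw [hc]; split_ifs <;> norm_num
      have h1 : 1 ≤ ENNReal.ofReal (ψ b) := by
        rw [← ENNReal.ofReal_one]; exact ENNReal.ofReal_le_ofReal (hψ b hb).1
      rw [Function.iterate_succ_apply, Function.iterate_succ_apply]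
      calc _ ≤ (ennTransfer r)^[n] (fun x => ENNReal.ofReal (c * κ) *
              singKernel a (markovMap r b) x + ENNReal.ofReal B * 1) x :=
            ennTransfer_mono hr (fun y hy => by
              rw [mul_one]; exact ennTransfer_singKernel_le hr ha hb hy hη) n x hx
        _ = ENNReal.ofReal (c * κ) * (ennTransfer r)^[n] (singKernel a (markovMap r b)) x
            + ENNReal.ofReal B * (ennTransfer r)^[n] (fun _ => 1) x := by
            rw [ennTransfer_add r (fun x => ENNReal.ofReal (c * κ) *
              singKernel a (markovMap r b) x), ennTransfer_const_mul r _
              (singKernel a (markovMap r b)), ennTransfer_const_mul r _ (fun _ => 1)]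
        _ ≤ ENNReal.ofReal (c * κ) * (ENNReal.ofReal (ψ (markovMap r b)) *
              (ENNReal.ofReal ρ ^ n * singKernel a ((markovMap r)^[n] (markovMap r b)) x
                + ENNReal.ofReal K)) + ENNReal.ofReal B * ENNReal.ofReal (1 / (1 - r)) := by
            gcongr
            · exact ih _ hT x hx
            · exact ennTransfer_one_le hr n x hx
        _ ≤ ENNReal.ofReal ρ * ENNReal.ofReal (ψ b) *
              (ENNReal.ofReal ρ ^ n * singKernel a ((markovMap r)^[n] (markovMap r b)) x
                + ENNReal.ofReal K) + ENNReal.ofReal (ψ b) *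
              (ENNReal.ofReal B * ENNReal.ofReal (1 / (1 - r))) := by
            refine add_le_add ?_ (le_mul_of_one_le_left' h1)
            rw [← mul_assoc]
            refine mul_le_mul_left ?_ _
            rw [← ENNReal.ofReal_mul (mul_nonneg hc0 hκ.1.le), ← ENNReal.ofReal_mul hρ.1.le]
            exact ENNReal.ofReal_le_ofReal (hψT b hb)
        _ = ENNReal.ofReal (ψ b) * (ENNReal.ofReal ρ ^ (n + 1) *
              singKernel a ((markovMap r)^[n] (markovMap r b)) x + (ENNReal.ofReal ρ *
                ENNReal.ofReal K + ENNReal.ofReal B * ENNReal.ofReal (1 / (1 - r)))) := by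
            ring
        _ = _ := by
            rw [← ENNReal.ofReal_mul hρ.1.le, ← ENNReal.ofReal_mul hB0.le,
              ← ENNReal.ofReal_add (mul_nonneg hρ.1.le hK0.le) (by positivity), hKeq]
  refine ⟨ρ, hρ, 9 * (1 + K), by positivity, fun n b hb x hx => (main n b hb x hx).trans ?_⟩
  rw [ENNReal.ofReal_mul (by norm_num), mul_assoc]
  refine mul_le_mul' (ENNReal.ofReal_le_ofReal (hψ b hb).2) ?_
  rw [mul_add, mul_one]
  refine add_le_add (le_mul_of_one_le_left' ?_) (ENNReal.ofReal_le_ofReal (by linarith))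
  rw [← ENNReal.ofReal_one]
  exact ENNReal.ofReal_le_ofReal (by linarith)

/-! ### Singular observables: integrability and truncation -/

lemma integrableOn_abs_sub_rpow {α : ℝ} (hα : α < 1) {β : ℝ} (hβ : β ∈ Icc (0 : ℝ) 1) :
    IntegrableOn (fun x => |β - x| ^ (-α)) (Icc 0 1) := by
  have h1 : IntervalIntegrable (fun t : ℝ => |t| ^ (-α)) volume 0 1 := by
    refine (intervalIntegral.intervalIntegrable_rpow' (r := -α) (by linarith)).congr_ae ?_
    refine (ae_restrict_iff' measurableSet_uIoc).2 (Eventually.of_forall fun t ht => ?_)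
    rw [uIoc_of_le zero_le_one] at ht
    simp only [abs_of_pos ht.1]
  have h2 : IntervalIntegrable (fun t : ℝ => |t| ^ (-α)) volume (-1) 0 := by
    have := (IntervalIntegrable.iff_comp_neg (by finiteness)).1 h1
    simpa using! this.symm
  have h3 := (h2.trans h1).comp_sub_left β (by finiteness)
  have h4 := h3.symm
  rw [intervalIntegrable_iff_integrableOn_Icc_of_le (by linarith)] at h4
  exact h4.mono_set (Icc_subset_Icc (by linarith [hβ.2]) (by linarith [hβ.1]))

lemma BoundedVariationOn.integrableOn_Icc {u : ℝ → ℝ} {a b : ℝ}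
    (hu : BoundedVariationOn u (Icc a b)) : IntegrableOn u (Icc a b) := by
  obtain ⟨p, q, hp, hq, rfl⟩ := hu.locallyBoundedVariationOn.exists_monotoneOn_sub_monotoneOn
  exact (hp.integrableOn_isCompact isCompact_Icc).sub (hq.integrableOn_isCompact isCompact_Icc)

lemma singularity_of_ne {β α x : ℝ} (h : x ≠ β) :
    singularity β α x = ((|β - x| ^ (-α) : ℝ) : EReal) := by
  have ht : 0 < |β - x| := abs_pos.2 (sub_ne_zero.2 h.symm)
  rw [singularity, ENNReal.ofReal_rpow_of_pos ht, EReal.coe_ennreal_ofReal,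
    max_eq_left (by positivity)]

lemma singularity_self {β α : ℝ} (hα : 0 < α) : singularity β α β = ⊤ := by
  simp [singularity, ENNReal.zero_rpow_of_neg, hα]

namespace SingularObservable

variable {β α : ℝ} {v : ℝ → EReal}

lemma apply_self (hv : SingularObservable β α v) (hα : 0 < α) : v β = ⊤ := by
  obtain ⟨U, -, -, hβU, C₁, C₂, h1, -, h⟩ := hv.order
  have := (h β hβU).1
  rwa [singularity_self hα, EReal.coe_mul_top_of_pos h1, top_le_iff] at this

lemma coe_toReal_apply (hv : SingularObservable β α v) {x : ℝ} (hx : x ∈ Icc (0 : ℝ) 1)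
    (hxβ : x ≠ β) : ((v x).toReal : EReal) = v x :=
  EReal.coe_toReal (hv.finite x hx hxβ).2 (hv.finite x hx hxβ).1

lemma exists_bounds_near (hv : SingularObservable β α v) : ∃ δ > 0, ∃ C₁ > 0, ∃ C₂ > 0,
    ∀ x ∈ Icc (0 : ℝ) 1, x ≠ β → |β - x| < δ →
      C₁ * |β - x| ^ (-α) ≤ (v x).toReal ∧ (v x).toReal ≤ C₂ * |β - x| ^ (-α) := by
  obtain ⟨U, ⟨O, hO, rfl⟩, -, hβU, C₁, C₂, h1, h2, h⟩ := hv.order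
  obtain ⟨δ, hδ, hball⟩ := Metric.isOpen_iff.1 hO β hβU.1
  refine ⟨δ, hδ, C₁, h1, C₂, h2, fun x hx hxβ hxδ => ?_⟩
  have := h x ⟨hball (by rwa [Metric.mem_ball, dist_comm, Real.dist_eq]), hx⟩
  rw [singularity_of_ne hxβ, ← hv.coe_toReal_apply hx hxβ, ← EReal.coe_mul, ← EReal.coe_mul,
    EReal.coe_le_coe_iff, EReal.coe_le_coe_iff] at this
  exact this

lemma exists_bound_away (hv : SingularObservable β α v) {δ : ℝ} (hδ : 0 < δ) :
    ∃ B : ℝ, 0 ≤ B ∧ ∀ x ∈ Icc (0 : ℝ) 1, δ ≤ |β - x| → |(v x).toReal| ≤ B := by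
  have aux : ∀ a b : ℝ, Icc a b ⊆ Icc 0 1 \ {β} → ∃ B : ℝ, ∀ x ∈ Icc a b, |(v x).toReal| ≤ B := by
    intro a b hab
    have hbv := hv.boundedVariation a b hab
    refine ⟨|(v a).toReal| + (eVariationOn (fun x => (v x).toReal) (Icc a b)).toReal,
      fun x hx => ?_⟩
    have := hbv.dist_le hx (left_mem_Icc.2 (hx.1.trans hx.2))
    rw [Real.dist_eq] at this
    have h2 := abs_add_le (v a).toReal ((v x).toReal - (v a).toReal)
    rw [add_sub_cancel] at h2
    linarith
  by_cases hβ : β ∈ Icc (0 : ℝ) 1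
  swap
  · obtain ⟨B, hB⟩ := aux 0 1 fun x hx => ⟨hx, fun h => hβ (h ▸ hx)⟩
    exact ⟨B, (abs_nonneg _).trans (hB 0 (by simp)), fun x hx _ => hB x hx⟩
  obtain ⟨B, hB⟩ := aux 0 (β - δ) fun x hx => ⟨⟨hx.1, by linarith [hx.2, hβ.2]⟩, fun h => by
    rw [mem_singleton_iff] at h; linarith [hx.2]⟩
  obtain ⟨B', hB'⟩ := aux (β + δ) 1 fun x hx => ⟨⟨by linarith [hx.1, hβ.1], hx.2⟩, fun h => by
    rw [mem_singleton_iff] at h; linarith [hx.1]⟩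
  refine ⟨max 0 (max B B'), le_max_left _ _, fun x hx hxδ => ?_⟩
  rcases le_abs.1 hxδ with h | h
  · exact (hB x ⟨hx.1, by linarith⟩).trans (le_max_of_le_right (le_max_left _ _))
  · exact (hB' x ⟨by linarith, hx.2⟩).trans (le_max_of_le_right (le_max_right _ _))

lemma exists_abs_le (hv : SingularObservable β α v) : ∃ B : ℝ, ∃ C : ℝ,
    ∀ x ∈ Icc (0 : ℝ) 1, x ≠ β → |(v x).toReal| ≤ B + C * |β - x| ^ (-α) := by
  obtain ⟨δ, hδ, C₁, h1, C₂, h2, h⟩ := hv.exists_bounds_near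
  obtain ⟨B, hB0, hB⟩ := hv.exists_bound_away hδ
  refine ⟨B, C₂, fun x hx hxβ => ?_⟩
  have hp : 0 ≤ |β - x| ^ (-α) := by positivity
  rcases lt_or_ge (|β - x|) δ with hlt | hge
  · obtain ⟨hl, hu⟩ := h x hx hxβ hlt
    rw [abs_of_nonneg ((mul_nonneg h1.le hp).trans hl)]
    linarith
  · nlinarith [hB x hx hge, mul_nonneg h2.le hp]

end SingularObservable

/-- The truncation of a singular observable at height `M`. -/
def truncation (β : ℝ) (v : ℝ → EReal) (M : ℝ) : ℝ → ℝ := fun x =>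
  if x = β then M else min (v x).toReal M

namespace SingularObservable

variable {β α : ℝ} {v : ℝ → EReal}

lemma exists_large_near (hv : SingularObservable β α v) (hα : 0 < α) (M : ℝ) :
    ∃ δ > 0, ∀ x ∈ Icc (0 : ℝ) 1, x ≠ β → |β - x| < δ → M ≤ (v x).toReal := by
  obtain ⟨δ, hδ, C₁, h1, C₂, -, h⟩ := hv.exists_bounds_near
  have ht : Tendsto (fun t : ℝ => C₁ * t ^ (-α)) (𝓝[>] 0) atTop :=
    (tendsto_rpow_neg_nhdsGT_zero (by linarith)).const_mul_atTop h1
  obtain ⟨δ', hδ', h'⟩ := (eventually_nhdsWithin_iff.1 (ht.eventually_ge_atTop M)).exists_mem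
  obtain ⟨e, he, hb⟩ := Metric.mem_nhds_iff.1 hδ'
  refine ⟨min δ e, lt_min hδ he, fun x hx hxβ hxd => ?_⟩
  refine le_trans (h' |β - x| (hb ?_) (abs_pos.2 (sub_ne_zero.2 hxβ.symm)))
    (h x hx hxβ (hxd.trans_le (min_le_left _ _))).1
  rw [Metric.mem_ball, Real.dist_eq, sub_zero, abs_abs]
  exact hxd.trans_le (min_le_right _ _)

/-- The truncation is constantly `M` near `β`, and away from `β` it is a Lipschitz function of `v`,
which has bounded variation there. -/
lemma boundedVariationOn_truncation (hv : SingularObservable β α v) (hα : 0 < α)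
    (hβ : β ∈ Icc (0 : ℝ) 1) (M : ℝ) : BoundedVariationOn (truncation β v M) (Icc 0 1) := by
  obtain ⟨δ, hδ, hM⟩ := hv.exists_large_near hα M
  -- The inclusion is required only for `a < b`, since an outer interval degenerates to a point when
  -- `β` is close to `0` or `1`.
  have piece : ∀ a b : ℝ, (a < b → Icc a b ⊆ Icc 0 1 \ {β}) →
      BoundedVariationOn (truncation β v M) (Icc a b) := by
    intro a b hab
    rcases lt_or_ge a b with h | h
    · have hsub := hab h
      have h1 := (LipschitzWith.id.min_const M).comp_boundedVariationOn
        (hv.boundedVariation a b hsub)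
      have h2 := eVariationOn.congr (s := Icc a b) (f := truncation β v M)
        (g := (fun x => min (id x) M) ∘ fun x => (v x).toReal)
        (fun x hx => if_neg (fun h => (hsub hx).2 h))
      rw [BoundedVariationOn, h2]
      exact h1
    · exact BoundedVariationOn.of_subsingleton (subsingleton_Icc_of_ge h)
  set a := max 0 (β - δ / 2) with ha
  set b := min 1 (β + δ / 2) with hb
  have haβ : a ≤ β := max_le hβ.1 (by linarith)
  have hβb : β ≤ b := le_min hβ.2 (by linarith)
  have ha0 : 0 ≤ a := le_max_left _ _
  have hb1 : b ≤ 1 := min_le_left _ _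
  have e1 := eVariationOn.Icc_add_Icc (truncation β v M) (s := univ) ha0
    (haβ.trans hβb) (mem_univ _)
  have e2 := eVariationOn.Icc_add_Icc (truncation β v M) (s := univ) (ha0.trans (haβ.trans hβb))
    hb1 (mem_univ _)
  simp only [univ_inter] at e1 e2
  have p1 : BoundedVariationOn (truncation β v M) (Icc 0 a) := by
    refine piece 0 a fun h x hx => ⟨⟨hx.1, hx.2.trans (haβ.trans hβ.2)⟩, ?_⟩
    intro hxβ
    rw [mem_singleton_iff] at hxβ
    rcases lt_max_iff.1 h with h | h
    · exact lt_irrefl _ h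
    · have : a = β - δ / 2 := max_eq_right h.le
      linarith [hx.2]
  have p3 : BoundedVariationOn (truncation β v M) (Icc b 1) := by
    refine piece b 1 fun h x hx => ⟨⟨(hβ.1.trans hβb).trans hx.1, hx.2⟩, ?_⟩
    intro hxβ
    rw [mem_singleton_iff] at hxβ
    rcases min_lt_iff.1 h with h | h
    · exact lt_irrefl _ h
    · have : b = β + δ / 2 := min_eq_right h.le
      linarith [hx.1]
  have p2 : eVariationOn (truncation β v M) (Icc a b) = 0 := by
    refine eVariationOn.constant_on ?_
    have hval : ∀ x ∈ Icc a b, truncation β v M x = M := by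
      intro x hx
      unfold truncation
      split_ifs with h
      · rfl
      · refine min_eq_right (hM x ⟨ha0.trans hx.1, hx.2.trans hb1⟩ h ?_)
        have h1 : β - δ / 2 ≤ x := (le_max_right _ _).trans hx.1
        have h2 : x ≤ β + δ / 2 := hx.2.trans (min_le_right _ _)
        rw [abs_lt]
        constructor <;> linarith
    rintro _ ⟨x, hx, rfl⟩ _ ⟨y, hy, rfl⟩
    rw [hval x hx, hval y hy]
  rw [BoundedVariationOn, ← e2, ← e1, p2, add_zero]
  exact ENNReal.add_ne_top.2 ⟨p1, p3⟩

lemma ae_ne (β : ℝ) : ∀ᵐ x ∂(volume.restrict (Icc (0 : ℝ) 1)), x ∈ Icc (0 : ℝ) 1 ∧ x ≠ β := by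
  refine (ae_restrict_mem measurableSet_Icc).and ?_
  exact ae_restrict_of_ae (by simp [ae_iff])

lemma tendsto_truncation {x : ℝ} (hx : x ≠ β) :
    Tendsto (fun n : ℕ => truncation β v n x) atTop (𝓝 (v x).toReal) := by
  refine tendsto_const_nhds.congr' ?_
  filter_upwards [eventually_ge_atTop ⌈(v x).toReal⌉₊] with n hn
  rw [truncation, if_neg hx, min_eq_left (Nat.ceil_le.1 hn)]

lemma integrableOn (hv : SingularObservable β α v) (hα : α ∈ Ioo (0 : ℝ) 1)
    (hβ : β ∈ Icc (0 : ℝ) 1) : IntegrableOn (fun x => (v x).toReal) (Icc 0 1) := by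
  obtain ⟨B, C, h⟩ := hv.exists_abs_le
  have hg : IntegrableOn (fun x => B + C * |β - x| ^ (-α)) (Icc 0 1) :=
    (integrableOn_const (by simp)).add ((integrableOn_abs_sub_rpow hα.2 hβ).const_mul C)
  refine hg.mono' ?_ ?_
  -- Measurability comes from the truncations, which are integrable as functions of bounded
  -- variation and converge off `β`.
  · refine aestronglyMeasurable_of_tendsto_ae atTop (f := fun n : ℕ => truncation β v n)
      (fun n => (hv.boundedVariationOn_truncation hα.1 hβ n).integrableOn_Icc.1) ?_
    filter_upwards [ae_ne β] with x hx
    exact tendsto_truncation hx.2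
  · filter_upwards [ae_ne β] with x hx
    exact h x hx.1 hx.2

lemma tendsto_integral_truncation (hv : SingularObservable β α v) (hα : α ∈ Ioo (0 : ℝ) 1)
    (hβ : β ∈ Icc (0 : ℝ) 1) :
    Tendsto (fun n : ℕ => ∫ x in Icc (0 : ℝ) 1, truncation β v n x) atTop
      (𝓝 (∫ x in Icc (0 : ℝ) 1, (v x).toReal)) := by
  refine tendsto_integral_of_dominated_convergence (fun x => |(v x).toReal|)
    (fun n => (hv.boundedVariationOn_truncation hα.1 hβ n).integrableOn_Icc.1)
    (hv.integrableOn hα hβ).abs (fun n => ?_) ?_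
  · filter_upwards [ae_ne β] with x hx
    rw [truncation, if_neg hx.2, Real.norm_eq_abs]
    have hn : (0 : ℝ) ≤ n := n.cast_nonneg
    rcases le_total (v x).toReal n with h | h
    · rw [min_eq_left h]
    · rw [min_eq_right h, abs_of_nonneg hn]
      exact h.trans (le_abs_self _)
  · filter_upwards [ae_ne β] with x hx
    exact tendsto_truncation hx.2

lemma truncation_le (hv : SingularObservable β α v) (hα : 0 < α) (M : ℝ) :
    ∀ x ∈ Icc (0 : ℝ) 1, (truncation β v M x : EReal) ≤ v x := by
  intro x hx
  unfold truncation
  split_ifs with h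
  · rw [h, hv.apply_self hα]
    exact le_top
  · conv_rhs => rw [← hv.coe_toReal_apply hx h]
    exact EReal.coe_le_coe_iff.2 (min_le_left _ _)

/-- The larger exponent makes the excess small: `C₂ * s ^ (-α) ≤ ε * s ^ (-α')` for small `s`, and
farther from `β` the function lies below a high truncation level. -/
lemma eventually_le_truncation_add (hv : SingularObservable β α v) (hα : 0 < α) {α' : ℝ}
    (hα' : α < α') {ε : ℝ} (hε : 0 < ε) : ∀ᶠ n : ℕ in atTop, ∀ x ∈ Icc (0 : ℝ) 1,
      v x ≤ (truncation β v n x : EReal)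
        + ((ENNReal.ofReal ε * singKernel α' β x : ENNReal) : EReal) := by
  obtain ⟨δ, hδ, C₁, h1, C₂, h2, h⟩ := hv.exists_bounds_near
  have hd : 0 < α' - α := by linarith
  set t := min δ ((ε / C₂) ^ (1 / (α' - α))) with ht
  have ht0 : 0 < t := lt_min hδ (by positivity)
  obtain ⟨B, hB0, hB⟩ := hv.exists_bound_away ht0
  filter_upwards [eventually_ge_atTop ⌈B⌉₊] with n hn x hx
  have hBn : B ≤ n := Nat.ceil_le.1 hn
  by_cases hxβ : x = β
  · subst hxβ
    have : singKernel α' x x = ⊤ := by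
      simp [singKernel, ENNReal.zero_rpow_of_neg, hα.trans hα']
    rw [this, ENNReal.mul_top (by simpa using hε), EReal.coe_ennreal_top, EReal.coe_add_top]
    exact le_top
  · have hs : 0 < |β - x| := abs_pos.2 (sub_ne_zero.2 (Ne.symm hxβ))
    rw [singKernel, ENNReal.ofReal_rpow_of_pos hs, ← ENNReal.ofReal_mul hε.le,
      EReal.coe_ennreal_ofReal, max_eq_left (by positivity), ← EReal.coe_add,
      ← hv.coe_toReal_apply hx hxβ, EReal.coe_le_coe_iff, truncation, if_neg hxβ]
    have hpos : 0 ≤ ε * |β - x| ^ (-α') := by positivity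
    rcases le_total (v x).toReal n with hvn | hvn
    · rw [min_eq_left hvn]
      linarith
    · rw [min_eq_right hvn]
      rcases lt_or_ge (|β - x|) t with hlt | hge
      · have hu := (h x hx hxβ (hlt.trans_le (min_le_left _ _))).2
        have h3 : |β - x| ^ (α' - α) ≤ ε / C₂ := by
          calc _ ≤ ((ε / C₂) ^ (1 / (α' - α))) ^ (α' - α) :=
                Real.rpow_le_rpow hs.le (hlt.le.trans (min_le_right _ _)) hd.le
            _ = ε / C₂ := by
                rw [← Real.rpow_mul (by positivity), one_div_mul_cancel hd.ne', Real.rpow_one]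
        rw [le_div_iff₀ h2] at h3
        have h4 : |β - x| ^ (-α) = |β - x| ^ (α' - α) * |β - x| ^ (-α') := by
          rw [← Real.rpow_add hs]
          congr 1
          ring
        have h5 : 0 ≤ |β - x| ^ (-α') := by positivity
        have hn0 : (0 : ℝ) ≤ n := n.cast_nonneg
        rw [h4] at hu
        nlinarith
      · linarith [le_abs_self (v x).toReal, hB x hx hge]

end SingularObservable

/-! ### Extended-real iterates: upper and lower bounds -/

lemma perronFrobenius_apply {r x : ℝ} (hr : r ∈ Ico (0 : ℝ) 1) (hx : x ∈ Icc (0 : ℝ) 1)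
    (v : ℝ → EReal) : perronFrobenius r v x =
      (branchWeight r x : EReal) * v (branchZero r x)
        + (branchWeight r x : EReal) * v (branchOne r x) := by
  rw [perronFrobenius, (hasDerivAt_branchZero hr hx).deriv, (hasDerivAt_branchOne hr hx).deriv,
    abs_neg, abs_of_pos (branchWeight_pos hr hx)]

lemma perronFrobenius_mono {r : ℝ} (hr : r ∈ Ico (0 : ℝ) 1) {v w : ℝ → EReal}
    (h : ∀ x ∈ Icc (0 : ℝ) 1, v x ≤ w x) (n : ℕ) :
    ∀ x ∈ Icc (0 : ℝ) 1, (perronFrobenius r)^[n] v x ≤ (perronFrobenius r)^[n] w x := by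
  induction n with
  | zero => exact h
  | succ n ih =>
    intro x hx
    simp only [Function.iterate_succ_apply']
    rw [perronFrobenius_apply hr hx, perronFrobenius_apply hr hx]
    have hw : (0 : EReal) ≤ (branchWeight r x : EReal) :=
      EReal.coe_nonneg.2 (branchWeight_pos hr hx).le
    exact add_le_add (mul_le_mul_of_nonneg_left (ih _ (branchZero_mem hr hx)) hw)
      (mul_le_mul_of_nonneg_left (ih _ (branchOne_mem hr hx)) hw)

/-- A real plus a nonnegative extended real never produces `⊤ + ⊥`, so the operator splits into its
real and its nonnegative version. -/
lemma perronFrobenius_coe_add {r : ℝ} (hr : r ∈ Ico (0 : ℝ) 1) (u : ℝ → ℝ) (s : ℝ → ENNReal)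
    (n : ℕ) : ∀ x ∈ Icc (0 : ℝ) 1,
      (perronFrobenius r)^[n] (fun x => (u x : EReal) + (s x : EReal)) x =
        ((realTransfer r)^[n] u x : EReal) + ((ennTransfer r)^[n] s x : EReal) := by
  induction n with
  | zero => intro x _; rfl
  | succ n ih =>
    intro x hx
    simp only [Function.iterate_succ_apply']
    rw [perronFrobenius_apply hr hx, ih _ (branchZero_mem hr hx), ih _ (branchOne_mem hr hx),
      realTransfer, ennTransfer]
    have hw := (branchWeight_pos hr hx).le
    have hw' : (0 : EReal) ≤ (branchWeight r x : EReal) := EReal.coe_nonneg.2 hw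
    rw [EReal.left_distrib_of_nonneg_of_ne_top hw' (EReal.coe_ne_top _),
      EReal.left_distrib_of_nonneg_of_ne_top hw' (EReal.coe_ne_top _), add_add_add_comm,
      EReal.coe_mul, EReal.coe_add, EReal.coe_ennreal_mul, EReal.coe_ennreal_add,
      EReal.coe_ennreal_ofReal, max_eq_left hw,
      EReal.left_distrib_of_nonneg_of_ne_top hw' (EReal.coe_ne_top _),
      EReal.left_distrib_of_nonneg_of_ne_top hw' (EReal.coe_ne_top _)]

/-- One branch sends `T_r β` back to `β` and contributes `⊤`. Values `⊥` have to be excluded along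
the induction because `⊤ + ⊥ = ⊥`. -/
lemma perronFrobenius_iterate_orbit_eq_top {r : ℝ} (hr : r ∈ Ico (0 : ℝ) 1) (n : ℕ) :
    ∀ β ∈ Icc (0 : ℝ) 1, ∀ v : ℝ → EReal, (∀ x ∈ Icc (0 : ℝ) 1, v x ≠ ⊥) → v β = ⊤ →
      (perronFrobenius r)^[n] v ((markovMap r)^[n] β) = ⊤ := by
  induction n with
  | zero => intro β _ v _ h; exact h
  | succ n ih =>
    intro β hβ v hv htop
    have hT := markovMap_mem hr hβ
    have hbot : ∀ x ∈ Icc (0 : ℝ) 1, ∀ y ∈ Icc (0 : ℝ) 1,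
        (branchWeight r x : EReal) * v y ≠ ⊥ := by
      intro x hx y hy
      have hw := branchWeight_pos hr hx
      rcases eq_or_ne (v y) ⊤ with h | h
      · rw [h, EReal.coe_mul_top_of_pos hw]; exact top_ne_bot
      · rw [← EReal.coe_toReal h (hv y hy), ← EReal.coe_mul]
        exact EReal.coe_ne_bot _
    rw [Function.iterate_succ_apply, Function.iterate_succ_apply]
    refine ih _ hT _ (fun x hx => ?_) ?_
    · rw [perronFrobenius_apply hr hx, Ne, EReal.add_eq_bot_iff, not_or]
      exact ⟨hbot x hx _ (branchZero_mem hr hx), hbot x hx _ (branchOne_mem hr hx)⟩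
    · rw [perronFrobenius_apply hr hT]
      have hw := branchWeight_pos hr hT
      rcases le_total β (1 / 2) with h | h
      · rw [branchZero_markovMap hr ⟨hβ.1, h⟩, htop, EReal.coe_mul_top_of_pos hw]
        exact EReal.top_add_of_ne_bot (hbot _ hT _ (branchOne_mem hr hT))
      · rw [branchOne_markovMap hr ⟨h, hβ.2⟩, htop, EReal.coe_mul_top_of_pos hw]
        exact EReal.add_top_of_ne_bot (hbot _ hT _ (branchZero_mem hr hT))

lemma exists_invDensity_le {r : ℝ} (hr : r ∈ Ico (0 : ℝ) 1) :
    ∃ H > 0, ∀ x ∈ Icc (0 : ℝ) 1, 0 ≤ invDensity r x ∧ invDensity r x ≤ H := by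
  have h1 : 0 < 1 - r := by linarith [hr.2]
  have hpos := (invDensity_eq hr (x := 0) (by simp)).1
  refine ⟨1 / (1 - r) / ∫ t in Icc (0 : ℝ) 1, 1 / (1 - r + r * t), by positivity,
    fun x hx => ?_⟩
  have hp := density_denom_pos hr hx
  rw [(invDensity_eq hr hx).2]
  refine ⟨by positivity, div_le_div_of_nonneg_right ?_ hpos.le⟩
  exact one_div_le_one_div_of_le h1 (by nlinarith [hr.1, hx.1])

namespace SingularObservable

variable {r β α : ℝ} {v : ℝ → EReal}

lemma eventually_abs_equilibrium_sub_le (hr : r ∈ Ico (0 : ℝ) 1) (hv : SingularObservable β α v)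
    (hα : α ∈ Ioo (0 : ℝ) 1) (hβ : β ∈ Icc (0 : ℝ) 1) {ε : ℝ} (hε : 0 < ε) :
    ∀ᶠ N : ℕ in atTop, ∀ᶠ n : ℕ in atTop, ∀ x ∈ Icc (0 : ℝ) 1,
      |(realTransfer r)^[n] (truncation β v N) x - equilibrium r v x| ≤ ε := by
  obtain ⟨H, hH, hh⟩ := exists_invDensity_le hr
  have h1 := (Metric.tendsto_nhds.1 (hv.tendsto_integral_truncation hα hβ)) (ε / 2 / H)
    (by positivity)
  filter_upwards [h1] with N hN
  have hbv := hv.boundedVariationOn_truncation hα.1 hβ N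
  filter_upwards [realTransfer_tendsto hr hbv hbv.integrableOn_Icc (half_pos hε)] with n hn x hx
  rw [Real.dist_eq, lt_div_iff₀ hH] at hN
  have h3 : |(∫ t in Icc (0 : ℝ) 1, truncation β v N t) * invDensity r x - equilibrium r v x|
      ≤ ε / 2 := by
    rw [equilibrium, ← sub_mul, abs_mul, abs_of_nonneg (hh x hx).1]
    exact (mul_le_mul_of_nonneg_left (hh x hx).2 (abs_nonneg _)).trans hN.le
  have := abs_sub_le ((realTransfer r)^[n] (truncation β v N) x)
    ((∫ t in Icc (0 : ℝ) 1, truncation β v N t) * invDensity r x) (equilibrium r v x)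
  linarith [hn x hx]

lemma eventually_lt_perronFrobenius (hr : r ∈ Ico (0 : ℝ) 1) (hv : SingularObservable β α v)
    (hα : α ∈ Ioo (0 : ℝ) 1) (hβ : β ∈ Icc (0 : ℝ) 1) {ε : ℝ} (hε : 0 < ε) :
    ∀ᶠ n : ℕ in atTop, ∀ x ∈ Icc (0 : ℝ) 1,
      ((equilibrium r v x - ε : ℝ) : EReal) < (perronFrobenius r)^[n] v x := by
  obtain ⟨N, hN⟩ := (hv.eventually_abs_equilibrium_sub_le hr hα hβ (half_pos hε)).exists
  filter_upwards [hN] with n hn x hx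
  have h1 := perronFrobenius_mono hr
    (v := fun x => (truncation β v N x : EReal) + ((0 : ENNReal) : EReal)) (w := v)
    (fun y hy => by simpa using hv.truncation_le hα.1 N y hy) n x hx
  rw [perronFrobenius_coe_add hr _ (fun _ => 0) n x hx] at h1
  have h2 : ((realTransfer r)^[n] (truncation β v N) x : EReal) ≤
      (perronFrobenius r)^[n] v x :=
    le_trans (le_add_of_nonneg_right (EReal.coe_ennreal_nonneg _)) h1
  refine lt_of_lt_of_le (EReal.coe_lt_coe_iff.2 ?_) h2
  linarith [(abs_le.1 (hn x hx)).1]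

/-- The rate `σ` does not depend on `ε`, and the bound is uniform outside the ball of radius `σ ^ n`
about the moving pole. The uniform, the pointwise and the pre-periodic statements all draw their
upper bound from here. -/
lemma exists_eventually_perronFrobenius_lt (hr : r ∈ Ico (0 : ℝ) 1)
    (hv : SingularObservable β α v) (hα : α ∈ Ioo (0 : ℝ) 1) (hβ : β ∈ Icc (0 : ℝ) 1) :
    ∃ σ ∈ Ioo (0 : ℝ) 1, ∀ ε : ℝ, 0 < ε → ∀ᶠ n : ℕ in atTop, ∀ x ∈ Icc (0 : ℝ) 1,
      σ ^ n ≤ |(markovMap r)^[n] β - x| →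
        (perronFrobenius r)^[n] v x < ((equilibrium r v x + ε : ℝ) : EReal) := by
  obtain ⟨α', h1, h2⟩ := exists_between hα.2
  have hα'0 : 0 < α' := hα.1.trans h1
  obtain ⟨ρ, hρ, C, hC, hQ⟩ := exists_ennTransfer_iterate_singKernel_le hr ⟨hα'0, h2⟩
  -- With this `σ`, being at distance at least `σ ^ n` from the pole means `ρ ^ n * dist ^ (-α') ≤
  -- 1`.
  refine ⟨ρ ^ (1 / α'), ⟨Real.rpow_pos_of_pos hρ.1 _,
    Real.rpow_lt_one hρ.1.le hρ.2 (by positivity)⟩, fun ε hε => ?_⟩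
  -- The kernel iterate is then at most `2 * C`, so the excess contributes at most `ε / 4`.
  have he : 0 < ε / (8 * C) := by positivity
  obtain ⟨N, hN, hN'⟩ := ((hv.eventually_abs_equilibrium_sub_le hr hα hβ (half_pos hε)).and
    (hv.eventually_le_truncation_add hα.1 h1 he)).exists
  filter_upwards [hN] with n hn x hx hσ
  have hσ0 : 0 < (ρ ^ (1 / α')) ^ n := pow_pos (Real.rpow_pos_of_pos hρ.1 _) n
  have hpos : 0 < |(markovMap r)^[n] β - x| := hσ0.trans_le hσ
  have h3 := perronFrobenius_mono hr hN' n x hx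
  rw [perronFrobenius_coe_add hr _ (fun x => ENNReal.ofReal (ε / (8 * C)) * singKernel α' β x)
    n x hx, ennTransfer_const_mul r _ (singKernel α' β)] at h3
  have h4 : ENNReal.ofReal ρ ^ n * singKernel α' ((markovMap r)^[n] β) x ≤ 1 := by
    rw [singKernel, ENNReal.ofReal_rpow_of_pos hpos, ← ENNReal.ofReal_pow hρ.1.le,
      ← ENNReal.ofReal_mul (pow_nonneg hρ.1.le n), ← ENNReal.ofReal_one]
    refine ENNReal.ofReal_le_ofReal ?_
    have h5 : ρ ^ n ≤ |(markovMap r)^[n] β - x| ^ α' := by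
      calc ρ ^ n = ((ρ ^ (1 / α')) ^ n) ^ α' := by
            rw [← Real.rpow_natCast, ← Real.rpow_natCast, ← Real.rpow_mul hρ.1.le,
              ← Real.rpow_mul hρ.1.le]
            congr 1
            field_simp
        _ ≤ _ := Real.rpow_le_rpow hσ0.le hσ hα'0.le
    rw [Real.rpow_neg hpos.le, ← div_eq_mul_inv]
    exact div_le_one_of_le₀ h5 (by positivity)
  have h6 : ENNReal.ofReal (ε / (8 * C)) * (ennTransfer r)^[n] (singKernel α' β) x ≤
      ENNReal.ofReal (ε / 4) := by
    calc _ ≤ ENNReal.ofReal (ε / (8 * C)) * (ENNReal.ofReal C * (1 + 1)) := by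
          gcongr
          exact (hQ n β hβ x hx).trans (by gcongr)
      _ = ENNReal.ofReal (ε / (8 * C) * (C * (1 + 1))) := by
          rw [ENNReal.ofReal_mul he.le, ENNReal.ofReal_mul hC.le,
            ENNReal.ofReal_add zero_le_one zero_le_one, ENNReal.ofReal_one]
      _ = _ := by
          congr 1
          field_simp
          norm_num
  have h7 := h3.trans (add_le_add le_rfl (EReal.coe_ennreal_le_coe_ennreal_iff.2 h6))
  rw [EReal.coe_ennreal_ofReal, max_eq_left (by positivity), ← EReal.coe_add] at h7
  refine lt_of_le_of_lt h7 (EReal.coe_lt_coe_iff.2 ?_)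
  linarith [(abs_le.1 (hn x hx)).2]

lemma ne_bot_of_mem (hv : SingularObservable β α v) (hα : 0 < α) :
    ∀ x ∈ Icc (0 : ℝ) 1, v x ≠ ⊥ := by
  intro x hx
  by_cases h : x = β
  · rw [h, hv.apply_self hα]; exact top_ne_bot
  · exact (hv.finite x hx h).1

end SingularObservable

/-! ### Exceptional points and the limit set of the orbit -/

lemma tendsto_ereal_coe_of_forall_eventually {u : ℕ → EReal} {a : ℝ}
    (h : ∀ ε : ℝ, 0 < ε → ∀ᶠ n in atTop, ((a - ε : ℝ) : EReal) < u n ∧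
      u n < ((a + ε : ℝ) : EReal)) : Tendsto u atTop (𝓝 (a : EReal)) := by
  refine tendsto_order.2 ⟨fun b hb => ?_, fun b hb => ?_⟩
  · obtain ⟨c, hbc, hca⟩ := EReal.lt_iff_exists_real_btwn.1 hb
    have hca' : c < a := EReal.coe_lt_coe_iff.1 hca
    filter_upwards [h (a - c) (sub_pos.2 hca')] with n hn
    rw [sub_sub_cancel] at hn
    exact hbc.trans hn.1
  · obtain ⟨c, hac, hcb⟩ := EReal.lt_iff_exists_real_btwn.1 hb
    have hac' : a < c := EReal.coe_lt_coe_iff.1 hac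
    filter_upwards [h (c - a) (sub_pos.2 hac')] with n hn
    rw [add_sub_cancel] at hn
    exact hn.2.trans hcb

/-- The set of points that are exponentially close to a sequence infinitely often has Hausdorff
dimension zero. -/
lemma dimH_frequently_abs_sub_lt_pow {σ : ℝ} (hσ : σ ∈ Ioo (0 : ℝ) 1) (b : ℕ → ℝ) (S : Set ℝ) :
    dimH {x | x ∈ S ∧ ∃ᶠ n in atTop, |b n - x| < σ ^ n} = 0 := by
  refine le_antisymm (dimH_le fun d hd => ?_) bot_le
  by_contra hd0
  have hdpos : 0 < (d : ℝ) := by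
    simpa [pos_iff_ne_zero] using hd0
  set q := ENNReal.ofReal σ with hq
  have hq1 : q < 1 := by rw [hq, ENNReal.ofReal_lt_one]; exact hσ.2
  have hqd : q ^ (d : ℝ) < 1 := ENNReal.rpow_lt_one hq1 hdpos
  have hdiam : ∀ m : ℕ, Metric.ediam (Metric.ball (b m) (σ ^ m)) ≤ 2 * q ^ m := by
    intro m
    rw [hq, ← ENNReal.ofReal_pow hσ.1.le, ← Metric.eball_ofReal]
    exact Metric.ediam_eball_le
  -- For each `k`, the balls with index at least `k` cover the set. The sums of the `d`-th powers of
  -- their diameters are bounded by a convergent geometric series, so the measure is finite for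
  -- every `d > 0`.
  have hbound := Measure.hausdorffMeasure_le_liminf_tsum (ι := fun _ : ℕ => ℕ) (d : ℝ)
    {x | x ∈ S ∧ ∃ᶠ n in atTop, |b n - x| < σ ^ n} (l := atTop)
    (fun k : ℕ => 2 * q ^ k) (by
      have := ENNReal.Tendsto.const_mul (a := 2) (ENNReal.tendsto_pow_atTop_nhds_zero_of_lt_one hq1)
        (Or.inr (by simp))
      simpa using this)
    (fun k i => Metric.ball (b (k + i)) (σ ^ (k + i)))
    (Eventually.of_forall fun k i => (hdiam _).trans
      (by gcongr 2 * ?_; exact pow_le_pow_right_of_le_one' hq1.le (Nat.le_add_right k i)))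
    (Eventually.of_forall fun k x hx => by
      obtain ⟨m, hm, hxm⟩ := frequently_atTop.1 hx.2 k
      obtain ⟨i, rfl⟩ := Nat.exists_eq_add_of_le hm
      exact mem_iUnion.2 ⟨i, by rwa [Metric.mem_ball, dist_comm, Real.dist_eq]⟩)
  rw [hd, top_le_iff] at hbound
  have hsum : ∀ k : ℕ, ∑' i : ℕ, Metric.ediam (Metric.ball (b (k + i)) (σ ^ (k + i))) ^ (d : ℝ) ≤
      2 ^ (d : ℝ) * (1 - q ^ (d : ℝ))⁻¹ := by
    intro k
    rw [← ENNReal.tsum_geometric, ← ENNReal.tsum_mul_left]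
    refine ENNReal.tsum_le_tsum fun i => ?_
    calc _ ≤ (2 * q ^ (k + i)) ^ (d : ℝ) := ENNReal.rpow_le_rpow (hdiam _) hdpos.le
      _ = 2 ^ (d : ℝ) * (q ^ (d : ℝ)) ^ (k + i) := by
          rw [ENNReal.mul_rpow_of_nonneg _ _ hdpos.le, ← ENNReal.rpow_natCast,
            ← ENNReal.rpow_natCast, ← ENNReal.rpow_mul, ← ENNReal.rpow_mul, mul_comm (d : ℝ)]
      _ ≤ _ := by
          gcongr 2 ^ (d : ℝ) * ?_
          exact pow_le_pow_right_of_le_one' hqd.le (Nat.le_add_left i k)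
  have hle := liminf_le_liminf (f := (atTop : Filter ℕ)) (Eventually.of_forall hsum)
  rw [hbound, liminf_const, top_le_iff] at hle
  refine ENNReal.mul_ne_top (by simp) ?_ hle
  rw [ENNReal.inv_ne_top]
  exact (tsub_pos_of_lt hqd).ne'

/-- The closures of the orbit tails decrease to the limit set, so by compactness one of them already
misses `K`, and disjoint compact and closed sets are a positive distance apart. -/
lemma exists_eventually_le_abs_orbit_sub {r β : ℝ} {K : Set ℝ} (hK : IsCompact K)
    (hKΩ : Disjoint K (omegaLimitSet r β)) :
    ∃ δ > 0, ∀ᶠ n : ℕ in atTop, ∀ x ∈ K, δ ≤ |(markovMap r)^[n] β - x| := by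
  set F : ℕ → Set ℝ := fun k => closure {y | ∃ l : ℕ, k ≤ l ∧ y = (markovMap r)^[l] β} with hF
  have hanti : Antitone F := fun i j hij =>
    closure_mono fun y ⟨l, hl, hy⟩ => ⟨l, hij.trans hl, hy⟩
  obtain ⟨k, hk⟩ := hK.elim_directed_family_closed F (fun _ => isClosed_closure)
    (disjoint_iff_inter_eq_empty.1 hKΩ) hanti.directed_ge
  obtain ⟨δ, hδ, h⟩ := Metric.exists_pos_forall_lt_edist hK (isClosed_closure (s := _))
    (disjoint_iff_inter_eq_empty.2 hk)
  refine ⟨δ, hδ, ?_⟩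
  filter_upwards [eventually_ge_atTop k] with n hn x hx
  have h1 := h x hx _ (subset_closure ⟨n, hn, rfl⟩)
  rw [edist_dist, ← ENNReal.ofReal_coe_nnreal, dist_comm, Real.dist_eq] at h1
  exact (ENNReal.ofReal_lt_ofReal_iff'.1 h1).1.le

lemma IsPreperiodic.finite_range_orbit {r β : ℝ} (h : IsPreperiodic r β) :
    (range fun n : ℕ => (markovMap r)^[n] β).Finite := by
  obtain ⟨m, hm, n, hn⟩ := h
  refine ((Finset.range (n + m)).finite_toSet.image fun l => (markovMap r)^[l] β).subset ?_
  rintro _ ⟨l, rfl⟩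
  -- Beyond `n + m` the orbit point agrees with the one `m` steps earlier.
  induction l using Nat.strong_induction_on with
  | _ l ih =>
    rcases lt_or_ge l (n + m) with hl | hl
    · exact ⟨l, by simpa using hl, rfl⟩
    · obtain ⟨k, rfl⟩ := Nat.exists_eq_add_of_le hl
      have := ih (n + k) (by omega)
      simp only [hn k] at this
      exact this

lemma IsPreperiodic.mem_omegaLimitSet_iff {r β : ℝ} (h : IsPreperiodic r β) (x : ℝ) :
    x ∈ omegaLimitSet r β ↔ ∃ᶠ n : ℕ in atTop, (markovMap r)^[n] β = x := by
  rw [frequently_atTop, omegaLimitSet, mem_iInter]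
  refine forall_congr' fun k => ?_
  have hfin : {y | ∃ l : ℕ, k ≤ l ∧ y = (markovMap r)^[l] β}.Finite :=
    h.finite_range_orbit.subset fun y ⟨l, _, hy⟩ => ⟨l, hy.symm⟩
  rw [hfin.isClosed.closure_eq]
  exact ⟨fun ⟨l, hl, hy⟩ => ⟨l, hl, hy.symm⟩, fun ⟨l, hl, hy⟩ => ⟨l, hl, hy.symm⟩⟩

lemma IsPreperiodic.finite_omegaLimitSet {r β : ℝ} (h : IsPreperiodic r β) :
    (omegaLimitSet r β).Finite := by
  refine h.finite_range_orbit.subset fun x hx => ?_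
  obtain ⟨n, hn⟩ := ((h.mem_omegaLimitSet_iff x).1 hx).exists
  exact ⟨n, hn⟩

lemma IsPreperiodic.exists_le_abs_orbit_sub {r β : ℝ} (h : IsPreperiodic r β) (x : ℝ) :
    ∃ δ > 0, ∀ n : ℕ, (markovMap r)^[n] β ≠ x → δ ≤ |(markovMap r)^[n] β - x| := by
  have hfin : ((range fun n : ℕ => (markovMap r)^[n] β) \ {x}).Finite := h.finite_range_orbit.sdiff
  obtain ⟨δ, hδ, hball⟩ := Metric.isOpen_iff.1 hfin.isClosed.isOpen_compl x (fun hx => hx.2 rfl)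
  refine ⟨δ, hδ, fun n hn => ?_⟩
  by_contra! hlt
  exact hball (by rwa [Metric.mem_ball, Real.dist_eq]) ⟨⟨n, rfl⟩, hn⟩

lemma one_mem_eventualPeriods {r β : ℝ} {n : ℕ}
    (h : (markovMap r)^[n + 1] β = (markovMap r)^[n] β) : 1 ∈ eventualPeriods r β := by
  refine ⟨le_rfl, n, fun k => ?_⟩
  rw [add_comm n k, add_comm (n + 1) k, Function.iterate_add_apply, Function.iterate_add_apply, h]

end

/-! ### Proof of the theorem -/

/-- Uniform convergence of extended-real-valued functions to a real-valued limit on `K` is written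
out: from some `n` on, the values lie strictly within `ε` of the limit on all of `K`
(in particular they are finite there). -/
theorem theorem3p1 (r α β : ℝ) (hr : r ∈ Ico (0 : ℝ) 1) (hα : α ∈ Ioo (0 : ℝ) 1)
    (hβ : β ∈ Icc (0 : ℝ) 1) (v : ℝ → EReal) (hv : SingularObservable β α v) :
    IntegrableOn (fun x => (v x).toReal) (Icc 0 1) ∧
    (∀ K : Set ℝ, IsCompact K → K ⊆ Icc 0 1 \ omegaLimitSet r β →
      ∀ ε : ℝ, 0 < ε → ∀ᶠ n : ℕ in atTop, ∀ x ∈ K,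
        ((equilibrium r v x - ε : ℝ) : EReal) < (perronFrobenius r)^[n] v x ∧
        (perronFrobenius r)^[n] v x < ((equilibrium r v x + ε : ℝ) : EReal)) ∧
    (∃ E : Set ℝ, E ⊆ Icc 0 1 ∧ dimH E = 0 ∧ ∀ x ∈ Icc (0 : ℝ) 1 \ E,
      Tendsto (fun n : ℕ => (perronFrobenius r)^[n] v x) atTop
        (𝓝 ((equilibrium r v x : ℝ) : EReal))) ∧
    (IsPreperiodic r β → 1 < periodLength r β →
      (omegaLimitSet r β).Finite ∧ ∀ x ∈ omegaLimitSet r β,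
        liminf (fun n : ℕ => (perronFrobenius r)^[n] v x) atTop
            = ((equilibrium r v x : ℝ) : EReal) ∧
        limsup (fun n : ℕ => (perronFrobenius r)^[n] v x) atTop = ⊤) ∧
    (IsPreperiodic r β → periodLength r β = 1 →
      (∃ z : ℝ, omegaLimitSet r β = {z}) ∧ ∀ x ∈ omegaLimitSet r β,
        Tendsto (fun n : ℕ => (perronFrobenius r)^[n] v x) atTop (𝓝 ⊤)) := by
  obtain ⟨σ, hσ, hup⟩ := hv.exists_eventually_perronFrobenius_lt hr hα hβ
  have hlow := fun (ε : ℝ) (hε : 0 < ε) => hv.eventually_lt_perronFrobenius hr hα hβ hε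
  have htop : ∀ n : ℕ, (perronFrobenius r)^[n] v ((markovMap r)^[n] β) = ⊤ := fun n =>
    perronFrobenius_iterate_orbit_eq_top hr n β hβ v (hv.ne_bot_of_mem hα.1) (hv.apply_self hα.1)
  have hσδ : ∀ δ : ℝ, 0 < δ → ∀ᶠ n : ℕ in atTop, σ ^ n ≤ δ := fun δ hδ =>
    (tendsto_pow_atTop_nhds_zero_of_lt_one hσ.1.le hσ.2).eventually_le_const hδ
  refine ⟨hv.integrableOn hα hβ, fun K hK hKsub ε hε => ?_, ?_, fun hpre hper => ?_,
    fun hpre hper => ?_⟩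
  · obtain ⟨δ, hδ, hn⟩ := exists_eventually_le_abs_orbit_sub hK
      (disjoint_left.2 fun x hx => (hKsub hx).2)
    filter_upwards [hlow ε hε, hup ε hε, hn, hσδ δ hδ] with n h1 h2 h3 h4 x hx
    exact ⟨h1 x (hKsub hx).1, h2 x (hKsub hx).1 (h4.trans (h3 x hx))⟩
  · refine ⟨{x | x ∈ Icc (0 : ℝ) 1 ∧ ∃ᶠ n in atTop, |(markovMap r)^[n] β - x| < σ ^ n},
      fun x hx => hx.1, dimH_frequently_abs_sub_lt_pow hσ _ _, fun x hx => ?_⟩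
    have hx2 : ∀ᶠ n : ℕ in atTop, σ ^ n ≤ |(markovMap r)^[n] β - x| := by
      have h : ¬∃ᶠ n : ℕ in atTop, |(markovMap r)^[n] β - x| < σ ^ n :=
        fun h => hx.2 ⟨hx.1, h⟩
      exact (not_frequently.1 h).mono fun n hn => not_lt.1 hn
    refine tendsto_ereal_coe_of_forall_eventually fun ε hε => ?_
    filter_upwards [hlow ε hε, hup ε hε, hx2] with n h1 h2 h3
    exact ⟨h1 x hx.1, h2 x hx.1 h3⟩
  · refine ⟨hpre.finite_omegaLimitSet, fun x hx => ?_⟩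
    have hfreq := (hpre.mem_omegaLimitSet_iff x).1 hx
    have hxI : x ∈ Icc (0 : ℝ) 1 := by
      obtain ⟨n, hn⟩ := hfreq.exists
      exact hn ▸ markovMap_iterate_mem hr hβ n
    -- An orbit that stayed at `x` from some time on would have period length one.
    have hne : ∃ᶠ n : ℕ in atTop, (markovMap r)^[n] β ≠ x := by
      intro hev
      obtain ⟨N, hN⟩ := eventually_atTop.1 hev
      have h1 : 1 ∈ eventualPeriods r β := one_mem_eventualPeriods (n := N)
        ((not_not.1 (hN (N + 1) N.le_succ)).trans (not_not.1 (hN N le_rfl)).symm)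
      exact absurd (Nat.sInf_le h1) (not_le.2 hper)
    -- Visits to `x` give the value `⊤` infinitely often. At the infinitely many other times the
    -- orbit is at least `δ` away, and the upper bound applies once `σ ^ n ≤ δ`.
    obtain ⟨δ, hδ, hsep⟩ := hpre.exists_le_abs_orbit_sub x
    refine ⟨le_antisymm ?_ ?_, top_le_iff.1 (le_limsup_of_frequently_le'
      (hfreq.mono fun n hn => by rw [← hn, htop n]))⟩
    · refine EReal.le_of_forall_lt_iff_le.1 fun c hc => ?_
      have hc' : equilibrium r v x < c := EReal.coe_lt_coe_iff.1 hc
      refine liminf_le_of_frequently_le' ?_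
      refine (hne.and_eventually ((hup _ (sub_pos.2 hc')).and (hσδ δ hδ))).mono ?_
      rintro n ⟨h1, h2, h3⟩
      have := h2 x hxI (h3.trans (hsep n h1))
      rw [add_sub_cancel] at this
      exact this.le
    · refine EReal.ge_of_forall_gt_iff_ge.1 fun c hc => ?_
      have hc' : c < equilibrium r v x := EReal.coe_lt_coe_iff.1 hc
      refine le_liminf_of_le (by isBoundedDefault) ?_
      filter_upwards [hlow _ (sub_pos.2 hc')] with n hn
      have := hn x hxI
      rw [sub_sub_cancel] at this
      exact this.le
  · obtain ⟨-, N, hN⟩ : 1 ∈ eventualPeriods r β := by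
      have := Nat.sInf_mem hpre
      rwa [← periodLength, hper] at this
    have hconst : ∀ n : ℕ, N ≤ n → (markovMap r)^[n] β = (markovMap r)^[N] β := by
      intro n hn
      induction n, hn using Nat.le_induction with
      | base => rfl
      | succ n hn ih =>
        obtain ⟨k, rfl⟩ := Nat.exists_eq_add_of_le hn
        rw [show N + k + 1 = N + 1 + k by omega, ← hN k, ih]
    have hΩ : omegaLimitSet r β = {(markovMap r)^[N] β} := by
      ext x
      rw [hpre.mem_omegaLimitSet_iff, mem_singleton_iff]
      constructor
      · intro h
        obtain ⟨n, h1, h2⟩ := (h.and_eventually (eventually_ge_atTop N)).exists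
        rw [← h1, hconst n h2]
      · rintro rfl
        exact Eventually.frequently (by
          filter_upwards [eventually_ge_atTop N] with n hn using hconst n hn)
    refine ⟨⟨_, hΩ⟩, fun x hx => ?_⟩
    rw [hΩ, mem_singleton_iff] at hx
    refine tendsto_const_nhds.congr' ?_
    filter_upwards [eventually_ge_atTop N] with n hn
    rw [hx, ← hconst n hn, htop n]
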